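/- Let $\nu\neq 0$ be a finite Borel measure on $(0,1)$ and let $\Lambda$ denote Lebesgue measure. **Spectral dimensions.** Let $H^1_0$ be the space of $f:[0,1]\to\mathbb R$ with $f(0)=f(1)=0$ for which there is $\nabla f\in L^2([0,1],\Lambda)$ with $f(x)=f(0)+\int_0^x\nabla f\,d\Lambda$ for all $x\in[0,1]$, and let $\operatorname{dom}\mathcal E_\nu$ be the space of those $f\in H^1_0$ that are affine on every connected component of $[0,1]\setminus\operatorname{supp}\nu$. A nonzero $f\in\operatorname{dom}\mathcal E_\nu$ is an eigenfunction with eigenvalue $\lambda$ if $\int_0^1\nabla f\,\nabla g\,d\Lambda=\lambda\int fg\,d\nu$ for all $g\in\operatorname{dom}\mathcal E_\nu$. Let $N_\nu(x)$ be the number of eigenvalues not exceeding $x$, counted with multiplicity, and $$\underline s_\nu=\liminf_{x\to\infty}\frac{\log N_\nu(x)}{\log x},\qquad \overline s_\nu=\limsup_{x\to\infty}\frac{\log N_\nu(x)}{\log x}.$$ If the two coincide, the common value $s_\nu$ is called the spectral dimension. **Partition entropies.** Let $\mathcal N^R(x)$ be the least $n$ for which there are $0=c_0<c_1<\dots<c_n=1$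 with $\nu(\{c_k\})=0$ for all $k$ and $\nu(C)\Lambda(C)<1/x$ for every $C=(c_{k-1},c_k]$, $1\le k\le n$. For $m>1$ let $\mathcal N^L_m(x)$ be the supremum of the cardinalities of finite families of pairwise disjoint intervals $C=(a,b]$, $0\le a<b\le1$, $\nu(\{a\})=\nu(\{b\})=0$, with $\nu(\langle C\rangle_m)\Lambda(\langle C\rangle_m)\ge\frac{4}{x(m-1)}$ for every member $C$, where $\langle C\rangle_m$ is the closed interval of length $\Lambda(C)/m$ with the same centre as $C$. Let $\underline h_\nu,\overline h_\nu$ and $\underline h^m_\nu,\overline h^m_\nu$ be the lower and upper limits, as $x\to\infty$, of $\log\mathcal N^R(x)/\log x$ and of $\log\mathcal N^L_m(x)/\log x$. **$L^q$-spectrum and coarse multifractal dimensions.** Let $\mathcal D_n$ be the set of the intervals $(k2^{-n},(k+1)2^{-n}]$, $0\le k<2^n$, and $$\beta_n(q)=\frac1{\log 2^n}\log\sum_{C\in\mathcal D_n,\ \nu(C)>0}\nu(C)^q,\qquad q\in\mathbb R.$$ For every $n\ge1$ with $2^n>\nu((0,1))$, the function $\beta_n$ has a unique fixed point $q_n$;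 put $\overline q_\nu=\limsup_n q_n$. With $\mathcal N_\alpha(n)=\#\{C\in\mathcal D_n:\nu(C)\ge2^{-\alpha n}\}$ and $\log^+t=\max(0,\log t)$, $\log^+0=0$, put $$\underline F_\nu=\sup_{\alpha>0}\frac1{1+\alpha}\liminf_{n\to\infty}\frac{\log^+\mathcal N_\alpha(n)}{\log2^n},\qquad \overline F_\nu=\sup_{\alpha>0}\frac1{1+\alpha}\limsup_{n\to\infty}\frac{\log^+\mathcal N_\alpha(n)}{\log2^n}.$$ Call $\nu$ *regular* if $\sup_{m>1}\underline h^m_\nu=\overline h_\nu$, and *MF-regular* if $\underline F_\nu=\overline F_\nu$. **Theorem.** 1. For all $1<m\le3$, $$\underline F_\nu\le\underline h^m_\nu\le\underline s_\nu\le\underline h_\nu\le\overline h_\nu=\overline h^m_\nu=\overline s_\nu=\overline q_\nu=\overline F_\nu .$$ 2. $\overline q_\nu\le\frac12$. 3. If $\underline s_\nu=\overline s_\nu$, then $\underline h_\nu=\overline h_\nu=s_\nu$. 4. If $\nu$ is regular, then $\underline s_\nu=\overline s_\nu=\overline h_\nu$. 5. If $\nu$ is MF-regular, then equality holds everywhere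 in the chain of part 1 for all $1<m\le3$, and $\nu$ is regular. 6. If $\underline h^m_\nu\ge\frac12$ for some $m>1$, then $\underline s_\nu=\overline s_\nu=\frac12=\overline h_\nu$. -/

import Mathlib

open MeasureTheory Filter Set
open scoped ENNReal unitInterval

noncomputable section

namespace KreinFeller

/-! Throughout, `ν` is a Borel measure on `ℝ`; the theorem assumes that it is finite, nonzero and
carried by `(0,1)`. The unit interval `[0,1]` is Mathlib's `unitInterval`, written `I`. -/

/-! ### The Dirichlet form and its eigenvalues -/

/-- `g ∈ L²([0,1])` is a weak derivative of `f`: `f x = f 0 + ∫₀ˣ g` for all `x ∈ [0,1]`. -/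
def HasWeakDeriv (f : C(I, ℝ)) (g : ℝ → ℝ) : Prop :=
  MemLp g 2 (volume.restrict (Icc (0 : ℝ) 1)) ∧
    ∀ x : I, f x = f 0 + ∫ t in (0 : ℝ)..(x : ℝ), g t

/-- The Sobolev space `H¹(0,1)`. -/
def MemH1 (f : C(I, ℝ)) : Prop := ∃ g : ℝ → ℝ, HasWeakDeriv f g

/-- The subspace `H¹₀(0,1)` of functions that vanish at both end points. -/
def MemH10 (f : C(I, ℝ)) : Prop := MemH1 f ∧ f 0 = 0 ∧ f 1 = 0

/-- The weak derivative of `f ∈ H¹(0,1)`. It is unique up to Lebesgue null sets, and every use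
below is under an integral. -/
def weakDeriv (f : C(I, ℝ)) : ℝ → ℝ := Classical.epsilon (HasWeakDeriv f)

/-- `f` is affine on each connected component of `[0,1] \ supp ν`. -/
def AffineOffSupport (ν : Measure ℝ) (f : C(I, ℝ)) : Prop :=
  ∀ x : I, (x : ℝ) ∉ ν.support →
    ∃ a b : ℝ, ∀ y ∈ connectedComponentIn {z : I | (z : ℝ) ∉ ν.support} x, f y = a * y + b

/-- The domain of the Dirichlet form. -/
def MemDom (ν : Measure ℝ) (f : C(I, ℝ)) : Prop := MemH10 f ∧ AffineOffSupport ν f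

/-- The energy `∫₀¹ f' g'`. -/
def energy (f g : C(I, ℝ)) : ℝ := ∫ t in Icc (0 : ℝ) 1, weakDeriv f t * weakDeriv g t

/-- The inner product of `L²(ν)`, where `ν` is viewed as a measure on `[0,1]`. -/
def innerL2 (ν : Measure ℝ) (f g : C(I, ℝ)) : ℝ :=
  ∫ x, f x * g x ∂(ν.comap (Subtype.val : I → ℝ))

/-- `f` is an eigenfunction of the Dirichlet form with eigenvalue `l`. -/
def IsEigenfunction (ν : Measure ℝ) (l : ℝ) (f : C(I, ℝ)) : Prop :=
  MemDom ν f ∧ f ≠ 0 ∧ ∀ g : C(I, ℝ), MemDom ν g → energy f g = l * innerL2 ν f g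

/-- The eigenvalue counting function: the number of eigenvalues not exceeding `x`, counted with
multiplicity, that is, the dimension of the space spanned by the eigenfunctions whose
eigenvalue is at most `x`. -/
def eigenvalueCount (ν : Measure ℝ) (x : ℝ) : ℕ∞ :=
  Cardinal.toENat (Module.rank ℝ
    (Submodule.span ℝ {f : C(I, ℝ) | ∃ l : ℝ, l ≤ x ∧ IsEigenfunction ν l f}))

/-! ### Exponents of growth -/

/-- `log N(x) / log x`, with `log 0 = -∞` and `log ∞ = ∞`. -/
def logRatio (N : ℝ → ℕ∞) (x : ℝ) : EReal :=
  ENNReal.log (N x : ℝ≥0∞) / ((Real.log x : ℝ) : EReal)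

/-- `limsup_{x → ∞} log N(x) / log x`. -/
def upperExponent (N : ℝ → ℕ∞) : EReal := limsup (logRatio N) atTop

/-- `liminf_{x → ∞} log N(x) / log x`. -/
def lowerExponent (N : ℝ → ℕ∞) : EReal := liminf (logRatio N) atTop

/-- The upper spectral dimension. -/
def upperSpectralDim (ν : Measure ℝ) : EReal := upperExponent (eigenvalueCount ν)

/-- The lower spectral dimension. -/
def lowerSpectralDim (ν : Measure ℝ) : EReal := lowerExponent (eigenvalueCount ν)

/-! ### Partition entropy -/

/-- `0 = c 0 < c 1 < ⋯ < c n = 1` are the cut points of a `ν`-partition of `(0,1]` into the `n`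
half-open intervals `(c k, c (k+1)]`: none of them is an atom of `ν`. -/
def IsPartition (ν : Measure ℝ) {n : ℕ} (c : Fin (n + 1) → ℝ) : Prop :=
  StrictMono c ∧ c 0 = 0 ∧ c (Fin.last n) = 1 ∧ ∀ k, ν {c k} = 0

/-- The least number of intervals in a `ν`-partition all of whose intervals `C` satisfy
`ν(C) Λ(C) < 1/x`. -/
def partitionCount (ν : Measure ℝ) (x : ℝ) : ℕ∞ :=
  sInf {N : ℕ∞ | ∃ (n : ℕ) (c : Fin (n + 1) → ℝ), N = n ∧ IsPartition ν c ∧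
    ∀ k : Fin n, ν.real (Ioc (c k.castSucc) (c k.succ)) *
      volume.real (Ioc (c k.castSucc) (c k.succ)) < 1 / x}

/-- The upper `ν`-partition entropy. -/
def upperEntropy (ν : Measure ℝ) : EReal := upperExponent (partitionCount ν)

/-- The lower `ν`-partition entropy. -/
def lowerEntropy (ν : Measure ℝ) : EReal := lowerExponent (partitionCount ν)

/-- The closed interval of length `(b - a) / m` with the same centre as the interval with end
points `a` and `b`. -/
def centered (m a b : ℝ) : Set ℝ :=
  Icc ((a + b) / 2 - (b - a) / (2 * m)) ((a + b) / 2 + (b - a) / (2 * m))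

/-- `P` is a finite disjoint collection of subintervals `(a,b]` of `[0,1]`, each given by its
end points, with no atom of `ν` at an end point. -/
def IsIntervalFamily (ν : Measure ℝ) (P : Finset (ℝ × ℝ)) : Prop :=
  (∀ p ∈ P, 0 ≤ p.1 ∧ p.1 < p.2 ∧ p.2 ≤ 1 ∧ ν {p.1} = 0 ∧ ν {p.2} = 0) ∧
    (P : Set (ℝ × ℝ)).PairwiseDisjoint fun p => Ioc p.1 p.2

/-- The largest number of intervals in such a collection for which
`ν(⟨C⟩ₘ) Λ(⟨C⟩ₘ) ≥ 4 / (x (m - 1))` for every member `C`. -/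
def reducedCount (ν : Measure ℝ) (m x : ℝ) : ℕ∞ :=
  sSup {N : ℕ∞ | ∃ P : Finset (ℝ × ℝ), N = P.card ∧ IsIntervalFamily ν P ∧
    ∀ p ∈ P, 4 / (x * (m - 1)) ≤
      ν.real (centered m p.1 p.2) * volume.real (centered m p.1 p.2)}

/-- The upper `m`-reduced `ν`-partition entropy. -/
def upperReducedEntropy (ν : Measure ℝ) (m : ℝ) : EReal := upperExponent (reducedCount ν m)

/-- The lower `m`-reduced `ν`-partition entropy. -/
def lowerReducedEntropy (ν : Measure ℝ) (m : ℝ) : EReal := lowerExponent (reducedCount ν m)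

/-! ### The `L^q`-spectrum and the coarse multifractal dimensions -/

/-- The dyadic interval `(k 2⁻ⁿ, (k+1) 2⁻ⁿ]`. -/
def dyadic (n k : ℕ) : Set ℝ := Ioc ((k : ℝ) / 2 ^ n) (((k : ℝ) + 1) / 2 ^ n)

open Classical in
/-- `βₙ(q) = (log 2ⁿ)⁻¹ log ∑ ν(C)^q`, the sum over the dyadic intervals of level `n` in `(0,1]`
with positive measure. -/
def lqBeta (ν : Measure ℝ) (n : ℕ) (q : ℝ) : ℝ :=
  1 / Real.log (2 ^ n) *
    Real.log (∑ k ∈ (Finset.range (2 ^ n)).filter (fun k => 0 < ν (dyadic n k)),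
      ν.real (dyadic n k) ^ q)

/-- The fixed point of `βₙ`. -/
def lqFixedPoint (ν : Measure ℝ) (n : ℕ) : ℝ := Classical.epsilon fun q : ℝ => lqBeta ν n q = q

/-- `limsup qₙ`, where `qₙ` is the fixed point of `βₙ`. -/
def upperFixedPoint (ν : Measure ℝ) : EReal :=
  limsup (fun n : ℕ => ((lqFixedPoint ν n : ℝ) : EReal)) atTop

open Classical in
/-- The number of dyadic intervals of level `n` in `(0,1]` of measure at least `2^(-α n)`. -/
def coarseCount (ν : Measure ℝ) (α : ℝ) (n : ℕ) : ℕ :=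
  ((Finset.range (2 ^ n)).filter
    (fun k => (2 : ℝ) ^ (-(α * n)) ≤ ν.real (dyadic n k))).card

/-- `log⁺ N_α(n) / log 2ⁿ`. -/
def coarseRatio (ν : Measure ℝ) (α : ℝ) (n : ℕ) : ℝ :=
  Real.posLog (coarseCount ν α n) / Real.log (2 ^ n)

/-- The upper optimized coarse multifractal dimension. -/
def upperCoarseDim (ν : Measure ℝ) : EReal :=
  ⨆ (α : ℝ) (_ : 0 < α),
    limsup (fun n : ℕ => ((coarseRatio ν α n : ℝ) : EReal)) atTop / ((1 + α : ℝ) : EReal)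

/-- The lower optimized coarse multifractal dimension. -/
def lowerCoarseDim (ν : Measure ℝ) : EReal :=
  ⨆ (α : ℝ) (_ : 0 < α),
    liminf (fun n : ℕ => ((coarseRatio ν α n : ℝ) : EReal)) atTop / ((1 + α : ℝ) : EReal)

/-! ### Regularity -/

/-- `ν` is regular. -/
def IsRegular (ν : Measure ℝ) : Prop :=
  (⨆ (m : ℝ) (_ : 1 < m), lowerReducedEntropy ν m) = upperEntropy ν

/-- `ν` is MF-regular. -/
def IsMFRegular (ν : Measure ℝ) : Prop := lowerCoarseDim ν = upperCoarseDim ν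

end KreinFeller

end

/-!
Dirichlet–Neumann bracketing over a partition bounds the eigenvalue counting function from above by
`partitionCount`; trapezoidal test functions, one for each interval of a disjoint family, bound it
from below by `reducedCount`. Hence `h^m ≤ s ≤ h`, for the lower and for the upper exponents.

It remains to close the circle of the upper exponents. Stopping the dyadic subdivision as soon as
mass times length is small gives a partition whose cells are counted by the fixed points of the
`L^q`-spectrum, so the upper entropy is at most the limit of the fixed points. Sorting the dyadic
intervals of one level by their mass bounds these fixed points by the coarse multifractal dimension.
Finally, among the dyadic intervals of large mass a fixed proportion can be enlarged by the factor
`m` and remain disjoint; their centred parts are then large in the sense of `reducedCount`, which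
bounds the coarse dimensions by the reduced entropies.
-/

noncomputable section

namespace KreinFeller

/-! ### Comparison of exponents -/

theorem logRatio_mono {N M : ℝ → ℕ∞} {x : ℝ} (hx : 1 ≤ x) (hNM : N x ≤ M x) :
    logRatio N x ≤ logRatio M x :=
  EReal.div_le_div_right_of_nonneg (mod_cast Real.log_nonneg hx)
    (ENNReal.log_monotone (mod_cast hNM))

theorem upperExponent_mono {N M : ℝ → ℕ∞} (hNM : ∀ᶠ x in atTop, N x ≤ M x) :
    upperExponent N ≤ upperExponent M := by
  refine limsup_le_limsup ?_
  filter_upwards [hNM, eventually_ge_atTop 1] with x hNMx hx using logRatio_mono hx hNMx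

theorem lowerExponent_mono {N M : ℝ → ℕ∞} (hNM : ∀ᶠ x in atTop, N x ≤ M x) :
    lowerExponent N ≤ lowerExponent M := by
  refine liminf_le_liminf ?_
  filter_upwards [hNM, eventually_ge_atTop 1] with x hNMx hx using logRatio_mono hx hNMx

theorem lowerExponent_le_upperExponent (N : ℝ → ℕ∞) : lowerExponent N ≤ upperExponent N :=
  liminf_le_limsup

theorem log_ofReal_rpow {x : ℝ} (hx : 0 < x) (t : ℝ) :
    ENNReal.log (ENNReal.ofReal (x ^ t)) = (t : EReal) * (Real.log x : ℝ) := by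
  rw [ENNReal.log_ofReal_of_pos (by positivity), Real.log_rpow hx, EReal.coe_mul]

theorem le_logRatio_of_rpow_le {N : ℝ → ℕ∞} {x t : ℝ} (hx : 1 < x)
    (hN : ENNReal.ofReal (x ^ t) ≤ (N x : ℝ≥0∞)) : (t : EReal) ≤ logRatio N x := by
  have hlog : 0 < Real.log x := Real.log_pos hx
  rw [logRatio, EReal.le_div_iff_mul_le (mod_cast hlog) (EReal.coe_ne_top _),
    ← log_ofReal_rpow (by positivity)]
  exact ENNReal.log_monotone hN

theorem logRatio_le_of_le_rpow {N : ℝ → ℕ∞} {x t : ℝ} {k : ℕ} (hx : 1 < x) (hN : N x ≤ k)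
    (hk : (k : ℝ) ≤ x ^ t) : logRatio N x ≤ (t : EReal) := by
  have hlog : 0 < Real.log x := Real.log_pos hx
  have hN_le : (N x : ℝ≥0∞) ≤ ENNReal.ofReal (x ^ t) :=
    (ENat.toENNReal_le.2 hN).trans (by simpa using ENNReal.ofReal_le_ofReal hk)
  rw [logRatio, EReal.div_le_iff_le_mul (mod_cast hlog) (EReal.coe_ne_top _), mul_comm,
    ← log_ofReal_rpow (by positivity)]
  exact ENNReal.log_monotone hN_le

/-! ### Sums of powers -/

section PowerSum

variable {ι : Type*} {s : Finset ι} {r : ι → ℝ}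

theorem strictAnti_sum_rpow (hs : s.Nonempty) (hr_pos : ∀ i ∈ s, 0 < r i)
    (hr_lt : ∀ i ∈ s, r i < 1) : StrictAnti fun q : ℝ => ∑ i ∈ s, r i ^ q := fun _ _ hpq =>
  Finset.sum_lt_sum_of_nonempty hs fun i hi =>
    Real.rpow_lt_rpow_of_exponent_gt (hr_pos i hi) (hr_lt i hi) hpq

theorem existsUnique_sum_rpow_eq_one (hs : s.Nonempty) (hr_pos : ∀ i ∈ s, 0 < r i)
    (hr_lt : ∀ i ∈ s, r i < 1) : ∃! q : ℝ, ∑ i ∈ s, r i ^ q = 1 := by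
  have hcont : Continuous fun q : ℝ => ∑ i ∈ s, r i ^ q :=
    continuous_finsetSum _ fun i hi => Real.continuous_const_rpow (hr_pos i hi).ne'
  have hlim : Tendsto (fun q : ℝ => ∑ i ∈ s, r i ^ q) atTop (nhds 0) := by
    simpa using tendsto_finsetSum s fun i (hi : i ∈ s) =>
      tendsto_rpow_atTop_of_base_lt_one (r i) (by linarith [hr_pos i hi]) (hr_lt i hi)
  obtain ⟨b, hb_lt, hb_nonneg⟩ :=
    ((hlim.eventually (gt_mem_nhds one_pos)).and (eventually_ge_atTop 0)).exists
  have hzero : (1 : ℝ) ≤ ∑ i ∈ s, r i ^ (0 : ℝ) := by simpa using hs.card_pos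
  obtain ⟨q, -, hq⟩ :=
    intermediate_value_Icc' hb_nonneg hcont.continuousOn ⟨hb_lt.le, hzero⟩
  exact ⟨q, hq, fun p hp => (strictAnti_sum_rpow hs hr_pos hr_lt).injective (hp.trans hq.symm)⟩

end PowerSum

/-! ### Dyadic intervals -/

theorem measurableSet_dyadic (n k : ℕ) : MeasurableSet (dyadic n k) := measurableSet_Ioc

theorem pairwise_disjoint_dyadic (n : ℕ) : Pairwise (Function.onFun Disjoint (dyadic n)) := by
  have hmono : Monotone fun k : ℕ => (k : ℝ) / 2 ^ n := fun k l hkl => by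
    dsimp only; gcongr
  intro k l hkl
  simpa [dyadic, Function.onFun] using hmono.pairwise_disjoint_on_Ioc_succ hkl

theorem exists_mem_dyadic (n : ℕ) {y : ℝ} (hy : y ∈ Ioc (0 : ℝ) 1) :
    ∃ k < 2 ^ n, y ∈ dyadic n k := by
  have hpow : (0 : ℝ) < 2 ^ n := by positivity
  obtain ⟨k, hk⟩ : ∃ k, ⌈y * 2 ^ n⌉₊ = k + 1 :=
    Nat.exists_eq_add_one.2 (Nat.ceil_pos.2 (mul_pos hy.1 hpow))
  obtain ⟨hlt, hle⟩ := (Nat.ceil_eq_iff k.succ_ne_zero).1 hk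
  push_cast [Nat.add_sub_cancel] at hlt hle
  refine ⟨k, ?_, (div_lt_iff₀ hpow).2 hlt, (le_div_iff₀ hpow).2 hle⟩
  exact_mod_cast hlt.trans_le (mul_le_of_le_one_left hpow.le hy.2)

theorem dyadic_subset_Ioc {n k : ℕ} (hk : k < 2 ^ n) : dyadic n k ⊆ Ioc 0 1 := by
  refine Ioc_subset_Ioc (by positivity) ((div_le_one (by positivity)).2 ?_)
  exact_mod_cast hk

theorem biUnion_dyadic (n : ℕ) : ⋃ k ∈ Finset.range (2 ^ n), dyadic n k = Ioc 0 1 := by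
  refine subset_antisymm (iUnion₂_subset fun k hk => dyadic_subset_Ioc (Finset.mem_range.1 hk))
    fun y hy => ?_
  simpa using exists_mem_dyadic n hy

theorem eventually_measureReal_univ_lt_two_pow (ν : Measure ℝ) :
    ∀ᶠ n : ℕ in atTop, ν.real univ < 2 ^ n :=
  (tendsto_pow_atTop_atTop_of_one_lt one_lt_two).eventually_gt_atTop _

open Classical in
/-- The indices of the dyadic intervals of level `n` that are charged by `ν`. -/
def charged (ν : Measure ℝ) (n : ℕ) : Finset ℕ :=
  (Finset.range (2 ^ n)).filter fun k => 0 < ν (dyadic n k)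

theorem mem_charged {ν : Measure ℝ} {n k : ℕ} :
    k ∈ charged ν n ↔ k < 2 ^ n ∧ 0 < ν (dyadic n k) := by
  simp [charged]

theorem charged_nonempty {ν : Measure ℝ} (hν : ν (Ioc 0 1) ≠ 0) (n : ℕ) :
    (charged ν n).Nonempty := by
  contrapose! hν
  rw [← biUnion_dyadic n]
  refine (measure_biUnion_null_iff (Finset.countable_toSet _)).2 fun k hk => ?_
  by_contra hne
  have hmem : k ∈ charged ν n := mem_charged.2 ⟨Finset.mem_range.1 hk, pos_iff_ne_zero.2 hne⟩
  simp [hν] at hmem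

/-! ### The fixed points of `βₙ` -/

section FixedPoint

variable {ν : Measure ℝ} [IsFiniteMeasure ν] {n k : ℕ}

variable (ν n) in
theorem sum_measureReal_dyadic_le :
    ∑ k ∈ Finset.range (2 ^ n), ν.real (dyadic n k) ≤ ν.real univ := by
  rw [← measureReal_biUnion_finset ((pairwise_disjoint_dyadic n).set_pairwise _)
    fun k _ => measurableSet_dyadic n k]
  exact measureReal_mono (subset_univ _)

theorem measureReal_pos_of_mem_charged (hk : k ∈ charged ν n) : 0 < ν.real (dyadic n k) :=
  ENNReal.toReal_pos (mem_charged.1 hk).2.ne' (measure_ne_top _ _)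

/-- `∑ (ν(C) Λ(C))^q` over the charged dyadic intervals `C` of level `n`. The fixed point of `βₙ`
is the exponent at which this sum equals `1`. -/
def dyadicSum (ν : Measure ℝ) (n : ℕ) (q : ℝ) : ℝ :=
  ∑ k ∈ charged ν n, (ν.real (dyadic n k) / 2 ^ n) ^ q

theorem lqBeta_eq_self_iff (hν : ν (Ioc 0 1) ≠ 0) (hn : n ≠ 0) (q : ℝ) :
    lqBeta ν n q = q ↔ dyadicSum ν n q = 1 := by
  have hlog : 0 < Real.log (2 ^ n) := Real.log_pos (one_lt_pow₀ one_lt_two hn)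
  have hsum_pos : 0 < ∑ k ∈ charged ν n, ν.real (dyadic n k) ^ q :=
    Finset.sum_pos (fun k hk => Real.rpow_pos_of_pos (measureReal_pos_of_mem_charged hk) _)
      (charged_nonempty hν n)
  have hsum : dyadicSum ν n q =
      (∑ k ∈ charged ν n, ν.real (dyadic n k) ^ q) / (2 ^ n : ℝ) ^ q := by
    rw [dyadicSum, Finset.sum_div]
    exact Finset.sum_congr rfl fun k _ => Real.div_rpow measureReal_nonneg (by positivity) _
  have hpow : (0 : ℝ) < (2 ^ n : ℝ) ^ q := by positivity
  change 1 / Real.log (2 ^ n) * Real.log (∑ k ∈ charged ν n, ν.real (dyadic n k) ^ q) = q ↔ _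
  rw [hsum, div_eq_one_iff_eq hpow.ne', one_div, inv_mul_eq_iff_eq_mul₀ hlog.ne', mul_comm,
    ← Real.log_rpow (by positivity), Real.log_injOn_pos.eq_iff hsum_pos hpow]

theorem dyadicRatio_pos (hk : k ∈ charged ν n) : 0 < ν.real (dyadic n k) / 2 ^ n :=
  div_pos (measureReal_pos_of_mem_charged hk) (by positivity)

theorem dyadicRatio_lt_one (hn : ν.real univ < 2 ^ n) (k : ℕ) :
    ν.real (dyadic n k) / 2 ^ n < 1 :=
  (div_lt_one (by positivity)).2 ((measureReal_mono (subset_univ _)).trans_lt hn)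

theorem existsUnique_lqBeta_eq_self (hν : ν (Ioc 0 1) ≠ 0) (hn : n ≠ 0)
    (hpow : ν.real univ < 2 ^ n) : ∃! q : ℝ, lqBeta ν n q = q := by
  simp only [lqBeta_eq_self_iff hν hn]
  exact existsUnique_sum_rpow_eq_one (charged_nonempty hν n) (fun k hk => dyadicRatio_pos hk)
    fun k _ => dyadicRatio_lt_one hpow k

theorem dyadicSum_strictAnti (hν : ν (Ioc 0 1) ≠ 0) (hpow : ν.real univ < 2 ^ n) :
    StrictAnti (dyadicSum ν n) :=
  strictAnti_sum_rpow (charged_nonempty hν n) (fun _ hk => dyadicRatio_pos hk)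
    fun k _ => dyadicRatio_lt_one hpow k

theorem dyadicSum_lqFixedPoint (hν : ν (Ioc 0 1) ≠ 0) (hn : n ≠ 0)
    (hpow : ν.real univ < 2 ^ n) : dyadicSum ν n (lqFixedPoint ν n) = 1 :=
  (lqBeta_eq_self_iff hν hn _).1 (Classical.epsilon_spec (p := fun q : ℝ => lqBeta ν n q = q)
    (existsUnique_lqBeta_eq_self hν hn hpow).exists)

theorem eventually_lqFixedPoint_lt_iff (hν : ν (Ioc 0 1) ≠ 0) :
    ∀ᶠ n : ℕ in atTop, ∀ q, lqFixedPoint ν n < q ↔ dyadicSum ν n q < 1 := by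
  filter_upwards [eventually_ne_atTop 0, eventually_measureReal_univ_lt_two_pow ν]
    with n hn hpow q
  rw [← dyadicSum_lqFixedPoint hν hn hpow, (dyadicSum_strictAnti hν hpow).lt_iff_gt]

theorem upperFixedPoint_nonneg (hν : ν (Ioc 0 1) ≠ 0) : 0 ≤ upperFixedPoint ν := by
  refine le_limsup_of_frequently_le (Eventually.frequently ?_)
  filter_upwards [eventually_lqFixedPoint_lt_iff hν] with n hlt_iff
  have hsum : 1 ≤ dyadicSum ν n 0 := by simpa [dyadicSum] using charged_nonempty hν n
  exact_mod_cast not_lt.1 fun hlt => hsum.not_gt ((hlt_iff 0).1 hlt)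

theorem upperFixedPoint_le_of_eventually {s : ℝ} (hν : ν (Ioc 0 1) ≠ 0)
    (hsum : ∀ᶠ n : ℕ in atTop, dyadicSum ν n s < 1) : upperFixedPoint ν ≤ (s : EReal) := by
  refine limsup_le_of_le (by isBoundedDefault) ?_
  filter_upwards [hsum, eventually_lqFixedPoint_lt_iff hν] with n hn hlt_iff
  exact_mod_cast ((hlt_iff s).2 hn).le

theorem eventually_dyadicSum_lt_one {s : ℝ} (hν : ν (Ioc 0 1) ≠ 0)
    (hs : upperFixedPoint ν < (s : EReal)) : ∀ᶠ n : ℕ in atTop, dyadicSum ν n s < 1 := by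
  filter_upwards [eventually_lt_of_limsup_lt hs, eventually_lqFixedPoint_lt_iff hν]
    with n hlt hlt_iff
  exact (hlt_iff s).1 (mod_cast hlt)

variable (ν n) in
theorem dyadicSum_half_le : dyadicSum ν n (1 / 2) ≤ √(ν.real univ) := by
  have hmass : ∑ k ∈ charged ν n, ν.real (dyadic n k) ≤ ν.real univ :=
    (Finset.sum_le_sum_of_subset_of_nonneg (Finset.filter_subset _ _)
      fun _ _ _ => measureReal_nonneg).trans (sum_measureReal_dyadic_le ν n)
  have hlength : ∑ k ∈ charged ν n, (2 ^ n : ℝ)⁻¹ ≤ 1 := by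
    have hcard : (charged ν n).card ≤ 2 ^ n := by
      simpa [charged] using Finset.card_filter_le (Finset.range (2 ^ n)) _
    rw [Finset.sum_const, nsmul_eq_mul, ← div_eq_mul_inv, div_le_one (by positivity)]
    exact_mod_cast hcard
  calc dyadicSum ν n (1 / 2)
      = ∑ k ∈ charged ν n, √(ν.real (dyadic n k)) * √((2 ^ n : ℝ)⁻¹) := by
        refine Finset.sum_congr rfl fun k _ => ?_
        rw [← Real.sqrt_eq_rpow, div_eq_mul_inv, Real.sqrt_mul measureReal_nonneg]
    _ ≤ √(∑ k ∈ charged ν n, ν.real (dyadic n k)) * √(∑ k ∈ charged ν n, (2 ^ n : ℝ)⁻¹) :=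
        Real.sum_sqrt_mul_sqrt_le _ (fun _ => measureReal_nonneg) fun _ => by positivity
    _ ≤ √(ν.real univ) * √1 := by gcongr
    _ = √(ν.real univ) := by simp

variable (ν n) in
theorem dyadicSum_add_le {p q : ℝ} (hq : 0 ≤ q) :
    dyadicSum ν n (p + q) ≤ dyadicSum ν n p * (ν.real univ / 2 ^ n) ^ q := by
  rw [dyadicSum, dyadicSum, Finset.sum_mul]
  refine Finset.sum_le_sum fun k hk => ?_
  have hpos := dyadicRatio_pos hk
  have hle : ν.real (dyadic n k) ≤ ν.real univ := measureReal_mono (subset_univ _)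
  rw [Real.rpow_add hpos]
  gcongr

theorem upperFixedPoint_le_half (hν : ν (Ioc 0 1) ≠ 0) :
    upperFixedPoint ν ≤ ((1 / 2 : ℝ) : EReal) := by
  refine EReal.le_of_forall_lt_iff_le.1 fun z hz => ?_
  obtain ⟨η, hη, rfl⟩ : ∃ η > 0, z = 1 / 2 + η :=
    ⟨z - 1 / 2, sub_pos.2 (by exact_mod_cast hz), by ring⟩
  have hlim : Tendsto (fun n : ℕ => √(ν.real univ) * (ν.real univ / 2 ^ n) ^ η) atTop
      (nhds 0) := by
    have hbase : Tendsto (fun n : ℕ => ν.real univ / 2 ^ n) atTop (nhds 0) :=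
      tendsto_const_nhds.div_atTop (tendsto_pow_atTop_atTop_of_one_lt one_lt_two)
    simpa [Real.zero_rpow hη.ne'] using
      (hbase.rpow_const (p := η) (Or.inr hη.le)).const_mul (√(ν.real univ))
  refine upperFixedPoint_le_of_eventually hν ?_
  filter_upwards [hlim.eventually (gt_mem_nhds one_pos)] with n hn
  calc dyadicSum ν n (1 / 2 + η)
      ≤ dyadicSum ν n (1 / 2) * (ν.real univ / 2 ^ n) ^ η := dyadicSum_add_le ν n hη.le
    _ ≤ √(ν.real univ) * (ν.real univ / 2 ^ n) ^ η := by
        gcongr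
        exact dyadicSum_half_le ν n
    _ < 1 := hn

end FixedPoint

/-! ### The coarse multifractal dimension and the fixed points -/

open Classical in
/-- The indices of the dyadic intervals of level `n` of measure at least `2^(-α n)`; there are
`coarseCount ν α n` of them. -/
def coarseSet (ν : Measure ℝ) (α : ℝ) (n : ℕ) : Finset ℕ :=
  (Finset.range (2 ^ n)).filter fun k => (2 : ℝ) ^ (-(α * n)) ≤ ν.real (dyadic n k)

theorem card_coarseSet (ν : Measure ℝ) (α : ℝ) (n : ℕ) :
    (coarseSet ν α n).card = coarseCount ν α n := rfl

theorem two_pow_rpow (n : ℕ) (t : ℝ) : ((2 : ℝ) ^ n) ^ t = 2 ^ (t * n) := by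
  rw [← Real.rpow_natCast, ← Real.rpow_mul (by norm_num), mul_comm]

theorem mem_coarseSet {ν : Measure ℝ} {α : ℝ} {n k : ℕ} :
    k ∈ coarseSet ν α n ↔ k < 2 ^ n ∧ ((2 : ℝ) ^ n) ^ (-α) ≤ ν.real (dyadic n k) := by
  simp [coarseSet, two_pow_rpow]

theorem log_two_pow_pos {n : ℕ} (hn : n ≠ 0) : 0 < Real.log ((2 : ℝ) ^ n) :=
  Real.log_pos (one_lt_pow₀ one_lt_two hn)

theorem coarseRatio_nonneg (ν : Measure ℝ) (α : ℝ) (n : ℕ) : 0 ≤ coarseRatio ν α n :=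
  div_nonneg Real.posLog_nonneg (Real.log_nonneg (one_le_pow₀ one_le_two))

theorem coarseCount_le_of_coarseRatio_le {ν : Measure ℝ} {α s : ℝ} {n : ℕ} (hn : n ≠ 0)
    (hs : coarseRatio ν α n ≤ s) : (coarseCount ν α n : ℝ) ≤ (2 ^ n) ^ s := by
  rcases (coarseCount ν α n).eq_zero_or_pos with hzero | hpos
  · rw [hzero, Nat.cast_zero]
    positivity
  · rw [coarseRatio, div_le_iff₀ (log_two_pow_pos hn), Real.posLog_eq_log_max_one
      (Nat.cast_nonneg _), max_eq_right (by exact_mod_cast hpos)] at hs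
    rw [← Real.log_le_log_iff (by exact_mod_cast hpos) (by positivity),
      Real.log_rpow (by positivity)]
    exact hs

theorem upperCoarseDim_nonneg (ν : Measure ℝ) : 0 ≤ upperCoarseDim ν := by
  refine le_iSup₂_of_le (1 : ℝ) one_pos (EReal.div_nonneg ?_ (by norm_num))
  refine le_limsup_of_frequently_le (Frequently.of_forall fun n => ?_)
  exact_mod_cast coarseRatio_nonneg ν 1 n

theorem eventually_coarseCount_le {ν : Measure ℝ} {s α : ℝ} (hα : 0 < α)
    (hs : upperCoarseDim ν < (s : EReal)) :
    ∀ᶠ n : ℕ in atTop, (coarseCount ν α n : ℝ) ≤ (2 ^ n) ^ (s * (1 + α)) := by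
  have hpos : (0 : EReal) < ((1 + α : ℝ) : EReal) := mod_cast (by linarith : (0 : ℝ) < 1 + α)
  have hlimsup : limsup (fun n : ℕ => ((coarseRatio ν α n : ℝ) : EReal)) atTop <
      ((s * (1 + α) : ℝ) : EReal) := by
    rw [EReal.coe_mul, ← EReal.div_lt_iff hpos (EReal.coe_ne_top _)]
    exact (le_iSup₂ (f := fun (α : ℝ) (_ : 0 < α) =>
      limsup (fun n : ℕ => ((coarseRatio ν α n : ℝ) : EReal)) atTop / ((1 + α : ℝ) : EReal))
      α hα).trans_lt hs
  filter_upwards [eventually_lt_of_limsup_lt hlimsup, eventually_ne_atTop 0] with n hlt hn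
  exact coarseCount_le_of_coarseRatio_le hn (mod_cast hlt.le)

theorem sum_le_sum_card_filter_mul {ι : Type*} {s : Finset ι} {f : ι → ℝ} {a : ℕ → ℝ}
    (ha : ∀ j, 0 ≤ a j) (hf : ∀ i ∈ s, f i ≤ a 0) (M : ℕ) :
    ∑ i ∈ s, f i ≤
      ∑ j ∈ Finset.range M, ({i ∈ s | a (j + 1) ≤ f i}.card : ℝ) * a j + s.card * a M := by
  have hpointwise : ∀ i ∈ s,
      f i ≤ ∑ j ∈ Finset.range M, (if a (j + 1) ≤ f i then a j else 0) + a M := by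
    intro i hi
    induction M with
    | zero => simpa using hf i hi
    | succ M ih =>
      rw [Finset.sum_range_succ]
      split_ifs with hM
      · linarith [ha (M + 1)]
      · have : 0 ≤ ∑ j ∈ Finset.range M, (if a (j + 1) ≤ f i then a j else 0) :=
          Finset.sum_nonneg fun j _ => ite_nonneg (ha j) le_rfl
        linarith
  refine (Finset.sum_le_sum hpointwise).trans_eq ?_
  rw [Finset.sum_add_distrib, Finset.sum_comm, Finset.sum_const, nsmul_eq_mul]
  simp_rw [← Finset.sum_filter, Finset.sum_const, nsmul_eq_mul]

section Coarse

variable {ν : Measure ℝ} [IsFiniteMeasure ν] {n M : ℕ} {s z η K : ℝ} {α : ℕ → ℝ}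

/-- The dyadic intervals are sorted into layers by their mass: those of the `j`-th layer have mass
at most `2^(-α j n)` and are counted by `coarseCount ν (α (j + 1)) n`. -/
theorem dyadicSum_le_sum_coarseCount (hz : 0 < z) (hK : 1 ≤ K) (hνK : ν.real univ ^ z ≤ K)
    (hα : α 0 = 0) (n M : ℕ) :
    dyadicSum ν n z ≤
      ∑ j ∈ Finset.range M, (coarseCount ν (α (j + 1)) n : ℝ) * (K * (2 ^ n) ^ (-(z * (1 + α j))))
        + 2 ^ n * (K * (2 ^ n) ^ (-(z * (1 + α M)))) := by
  have hratio (t : ℝ) : ((2 : ℝ) ^ n) ^ (-(z * (1 + t))) = ((2 ^ n) ^ (-t) / 2 ^ n) ^ z := by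
    rw [div_eq_mul_inv, ← Real.rpow_neg_one, ← Real.rpow_add (by positivity),
      ← Real.rpow_mul (by positivity)]
    ring_nf
  have hpow_nonneg (j : ℕ) : 0 ≤ K * ((2 : ℝ) ^ n) ^ (-(z * (1 + α j))) := by positivity
  have hbase (k : ℕ) :
      (ν.real (dyadic n k) / 2 ^ n) ^ z ≤ K * ((2 : ℝ) ^ n) ^ (-(z * (1 + α 0))) := by
    have hmass : ν.real (dyadic n k) ^ z ≤ ν.real univ ^ z :=
      Real.rpow_le_rpow measureReal_nonneg (measureReal_mono (subset_univ _)) hz.le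
    rw [hratio, hα, neg_zero, Real.rpow_zero, Real.div_rpow measureReal_nonneg (by positivity),
      Real.div_rpow zero_le_one (by positivity), Real.one_rpow, mul_one_div]
    gcongr
    exact hmass.trans hνK
  have hlayer (j : ℕ) : {k ∈ Finset.range (2 ^ n) | K * ((2 : ℝ) ^ n) ^ (-(z * (1 + α (j + 1)))) ≤
      (ν.real (dyadic n k) / 2 ^ n) ^ z} ⊆ coarseSet ν (α (j + 1)) n := by
    intro k hk
    obtain ⟨hk_lt, hk_le⟩ := Finset.mem_filter.1 hk
    refine mem_coarseSet.2 ⟨Finset.mem_range.1 hk_lt, ?_⟩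
    have hle := (le_mul_of_one_le_left (by positivity) hK).trans hk_le
    rw [hratio] at hle
    exact (div_le_div_iff_of_pos_right (by positivity)).1
      ((Real.rpow_le_rpow_iff (by positivity) (by positivity) hz).1 hle)
  calc dyadicSum ν n z ≤ ∑ k ∈ Finset.range (2 ^ n), (ν.real (dyadic n k) / 2 ^ n) ^ z :=
        Finset.sum_le_sum_of_subset_of_nonneg (Finset.filter_subset _ _) fun k _ _ => by positivity
    _ ≤ _ := sum_le_sum_card_filter_mul hpow_nonneg (fun k _ => hbase k) M
    _ ≤ _ := by
        simp only [Finset.card_range, Nat.cast_pow, Nat.cast_ofNat]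
        gcongr with j
        rw [← card_coarseSet]
        exact Finset.card_le_card (hlayer j)

theorem dyadicSum_le_of_coarseCount_le (hz : 0 < z) (hK : 1 ≤ K) (hνK : ν.real univ ^ z ≤ K)
    (hα : α 0 = 0) (hgap : ∀ j, s * (1 + α (j + 1)) + η ≤ z * (1 + α j))
    (hM : 1 + η ≤ z * (1 + α M))
    (hcount : ∀ j < M, (coarseCount ν (α (j + 1)) n : ℝ) ≤ (2 ^ n) ^ (s * (1 + α (j + 1)))) :
    dyadicSum ν n z ≤ (M + 1) * K * (2 ^ n) ^ (-η) := by
  have hone : (1 : ℝ) ≤ 2 ^ n := one_le_pow₀ one_le_two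
  have hpow {p q : ℝ} (hpq : p + η ≤ q) :
      ((2 : ℝ) ^ n) ^ p * (K * (2 ^ n) ^ (-q)) ≤ K * (2 ^ n) ^ (-η) := by
    rw [mul_left_comm, ← Real.rpow_add (by positivity)]
    gcongr
    linarith
  have hlayer : ∀ j ∈ Finset.range M, (coarseCount ν (α (j + 1)) n : ℝ) *
      (K * (2 ^ n) ^ (-(z * (1 + α j)))) ≤ K * (2 ^ n) ^ (-η) := fun j hj =>
    (mul_le_mul_of_nonneg_right (hcount j (Finset.mem_range.1 hj)) (by positivity)).trans
      (hpow (hgap j))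
  have hlast : (2 : ℝ) ^ n * (K * (2 ^ n) ^ (-(z * (1 + α M)))) ≤ K * (2 ^ n) ^ (-η) := by
    simpa using hpow hM
  calc dyadicSum ν n z ≤ _ := dyadicSum_le_sum_coarseCount hz hK hνK hα n M
    _ ≤ ∑ _j ∈ Finset.range M, K * ((2 : ℝ) ^ n) ^ (-η) + K * (2 ^ n) ^ (-η) := by
        exact add_le_add (Finset.sum_le_sum hlayer) hlast
    _ = (M + 1) * K * (2 ^ n) ^ (-η) := by
        rw [Finset.sum_const, Finset.card_range, nsmul_eq_mul]
        ring

theorem upperFixedPoint_le_upperCoarseDim (hν : ν (Ioc 0 1) ≠ 0) :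
    upperFixedPoint ν ≤ upperCoarseDim ν := by
  refine EReal.le_of_forall_lt_iff_le.1 fun z hz => upperFixedPoint_le_of_eventually hν ?_
  obtain ⟨s, hs, hsz⟩ := EReal.lt_iff_exists_real_btwn.1 hz
  have hs_pos : 0 < s := by exact_mod_cast (upperCoarseDim_nonneg ν).trans_lt hs
  have hsz : s < z := by exact_mod_cast hsz
  have hz_pos : 0 < z := hs_pos.trans hsz
  obtain ⟨η, hη, rfl⟩ : ∃ η > 0, z = s + 2 * η := ⟨(z - s) / 2, by linarith, by ring⟩
  obtain ⟨δ, hδ, hsδ⟩ : ∃ δ > 0, s * δ = η := ⟨η / s, by positivity, by field_simp⟩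
  obtain ⟨M, hM⟩ : ∃ M : ℕ, 1 + η ≤ (s + 2 * η) * (1 + M * δ) := by
    obtain ⟨M, hM⟩ := exists_nat_ge ((1 + η) / ((s + 2 * η) * δ))
    rw [div_le_iff₀ (by positivity)] at hM
    exact ⟨M, by nlinarith⟩
  set K := max 1 (ν.real univ ^ (s + 2 * η))
  have hlim : Tendsto (fun n : ℕ => (M + 1) * K * ((2 : ℝ) ^ n) ^ (-η)) atTop (nhds 0) := by
    simpa using ((tendsto_rpow_neg_atTop hη).comp
      (tendsto_pow_atTop_atTop_of_one_lt one_lt_two)).const_mul ((M + 1) * K)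
  have hcount : ∀ᶠ n : ℕ in atTop, ∀ j ∈ Finset.range M,
      (coarseCount ν ((j + 1 : ℕ) * δ) n : ℝ) ≤ (2 ^ n) ^ (s * (1 + (j + 1 : ℕ) * δ)) :=
    (eventually_all_finset _).2 fun j _ => eventually_coarseCount_le (by positivity) hs
  have hgap (j : ℕ) : s * (1 + (j + 1 : ℕ) * δ) + η ≤ (s + 2 * η) * (1 + j * δ) := by
    have : 0 ≤ η * (j * δ) := by positivity
    push_cast
    linarith
  filter_upwards [hlim.eventually (gt_mem_nhds one_pos), hcount] with n hlt hn
  exact (dyadicSum_le_of_coarseCount_le (α := fun j => j * δ) hz_pos (le_max_left _ _)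
    (le_max_right _ _) (by simp) hgap hM fun j hj => hn j (Finset.mem_range.2 hj)).trans_lt hlt

end Coarse

/-! ### Partitions whose cut points avoid the atoms -/

section Partition

variable {ν : Measure ℝ}

theorem countable_atoms [SFinite ν] : {y : ℝ | ν {y} ≠ 0}.Countable := by
  simpa only [pos_iff_ne_zero] using Measure.countable_meas_pos_of_disjoint_iUnion
    (μ := ν) (fun y => measurableSet_singleton y) fun _ _ hne => disjoint_singleton.2 hne

theorem continuousWithinAt_measureReal_Ioc [IsFiniteMeasure ν] (a b : ℝ) :
    ContinuousWithinAt (fun d => ν.real (Ioc a d)) (Ici b) b := by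
  rw [← continuousWithinAt_Ioi_iff_Ici]
  have hinter : ⋂ d > b, Ioc a d = Ioc a b := by
    ext y
    simp only [mem_iInter, mem_Ioc]
    exact ⟨fun hy => ⟨(hy (b + 1) (by simp)).1,
      le_of_forall_gt_imp_ge_of_dense fun d hd => (hy d hd).2⟩,
      fun hy d hd => ⟨hy.1, hy.2.trans (le_of_lt hd)⟩⟩
  have hlim := tendsto_measure_biInter_gt (μ := ν) (s := fun d => Ioc a d) (a := b)
    (fun _ _ => measurableSet_Ioc.nullMeasurableSet)
    (fun _ _ _ hle => Ioc_subset_Ioc_right hle) ⟨b + 1, by simp, measure_ne_top _ _⟩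
  rw [hinter] at hlim
  exact (ENNReal.tendsto_toReal (measure_ne_top _ _)).comp hlim

/-- A perturbation of the identity that fixes `0` and `1` and moves the points in between to the
right. It serves to move the cut points of a partition of `(0,1]` off the atoms of a measure. -/
def nudge (δ y : ℝ) : ℝ := y + δ * (y * (1 - y))

theorem le_nudge {δ y : ℝ} (hδ : 0 ≤ δ) (hy : y ∈ Icc (0 : ℝ) 1) : y ≤ nudge δ y :=
  le_add_of_nonneg_right (mul_nonneg hδ (mul_nonneg hy.1 (sub_nonneg.2 hy.2)))

theorem strictMonoOn_nudge {δ : ℝ} (hδ : δ ∈ Ioo (0 : ℝ) 1) :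
    StrictMonoOn (nudge δ) (Icc 0 1) := by
  intro a ha b hb hab
  have hfactor : nudge δ b - nudge δ a = (b - a) * (1 + δ * (1 - a - b)) := by
    unfold nudge
    ring
  have hslope : 0 < 1 + δ * (1 - a - b) := by nlinarith [hδ.1, hδ.2, ha.2, hb.2]
  exact sub_pos.1 (hfactor ▸ mul_pos (sub_pos.2 hab) hslope)

theorem tendsto_nudge {y : ℝ} (hy : y ∈ Icc (0 : ℝ) 1) :
    Tendsto (fun δ => nudge δ y) (nhdsWithin 0 (Ioi 0)) (nhdsWithin y (Ici y)) := by
  have hcont : Continuous fun δ => nudge δ y := by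
    unfold nudge
    fun_prop
  refine tendsto_nhdsWithin_iff.2 ⟨?_, ?_⟩
  · simpa [nudge] using (hcont.tendsto 0).mono_left nhdsWithin_le_nhds
  · filter_upwards [self_mem_nhdsWithin] with δ hδ using le_nudge (le_of_lt hδ) hy

theorem countable_setOf_nudge_atom [SFinite ν] (h0 : ν {0} = 0) (h1 : ν {1} = 0) (y : ℝ) :
    {δ | ν {nudge δ y} ≠ 0}.Countable := by
  by_cases hy : y * (1 - y) = 0
  · rcases mul_eq_zero.1 hy with rfl | hy
    · simp [nudge, h0]
    · obtain rfl : y = 1 := by linarith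
      simp [nudge, h1]
  · refine countable_atoms.preimage (f := fun δ => nudge δ y) fun δ δ' hδ => ?_
    exact mul_right_cancel₀ hy (add_left_cancel hδ)

theorem partitionCount_le_of_strictMono [IsFiniteMeasure ν] (h0 : ν {0} = 0) (h1 : ν {1} = 0)
    {n : ℕ} {c : Fin (n + 1) → ℝ} (hc : StrictMono c) (hc_zero : c 0 = 0)
    (hc_last : c (Fin.last n) = 1) {x : ℝ}
    (hgap : ∀ k : Fin n, ν.real (Ioc (c k.castSucc) (c k.succ)) * (c k.succ - c k.castSucc) <
      1 / x) :
    partitionCount ν x ≤ n := by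
  have hmem (i : Fin (n + 1)) : c i ∈ Icc (0 : ℝ) 1 :=
    ⟨hc_zero ▸ hc.monotone (Fin.zero_le i), hc_last ▸ hc.monotone (Fin.le_last i)⟩
  have hgap_nudge : ∀ᶠ δ in nhdsWithin 0 (Ioi 0), ∀ k : Fin n,
      ν.real (Ioc (c k.castSucc) (nudge δ (c k.succ))) * (nudge δ (c k.succ) - c k.castSucc) <
        1 / x := by
    refine eventually_all.2 fun k => ?_
    have hlim : ContinuousWithinAt (fun d => ν.real (Ioc (c k.castSucc) d) * (d - c k.castSucc))
        (Ici (c k.succ)) (c k.succ) :=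
      (continuousWithinAt_measureReal_Ioc _ _).mul (by fun_prop)
    exact (hlim.tendsto.comp (tendsto_nudge (hmem _))).eventually (gt_mem_nhds (hgap k))
  obtain ⟨v, hv, hv_gap⟩ := (mem_nhdsGT_iff_exists_Ioo_subset' one_pos).1 hgap_nudge
  obtain ⟨δ, hδ_atom, hδ⟩ := ((countable_iUnion fun i =>
    countable_setOf_nudge_atom h0 h1 (c i)).dense_compl ℝ).exists_between (lt_min hv one_pos)
  have hδ_gap := hv_gap ⟨hδ.1, hδ.2.trans_le (min_le_left _ _)⟩
  have hmono : StrictMono fun i => nudge δ (c i) := fun i j hij =>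
    strictMonoOn_nudge ⟨hδ.1, hδ.2.trans_le (min_le_right _ _)⟩ (hmem i) (hmem j) (hc hij)
  refine sInf_le ⟨n, fun i => nudge δ (c i), rfl, ⟨hmono, ?_, ?_, by simpa using hδ_atom⟩,
    fun k => ?_⟩
  · simp [nudge, hc_zero]
  · simp [nudge, hc_last]
  · have hlt : nudge δ (c k.castSucc) < nudge δ (c k.succ) := hmono Fin.castSucc_lt_succ
    have hle : c k.castSucc ≤ nudge δ (c k.castSucc) := le_nudge hδ.1.le (hmem _)
    rw [Real.volume_real_Ioc_of_le hlt.le]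
    refine lt_of_le_of_lt ?_ (hδ_gap k)
    exact mul_le_mul (measureReal_mono (Ioc_subset_Ioc_left hle)) (by linarith) (by linarith)
      measureReal_nonneg

theorem partitionCount_le_card [IsFiniteMeasure ν] (h0 : ν {0} = 0) (h1 : ν {1} = 0)
    {S : Finset ℝ} (hS_zero : 0 ∈ S) (hS_one : 1 ∈ S) (hS : ↑S ⊆ Icc (0 : ℝ) 1) {x : ℝ}
    (hgap : ∀ a ∈ S, ∀ b ∈ S, a < b → (∀ c ∈ S, c ≤ a ∨ b ≤ c) →
      ν.real (Ioc a b) * (b - a) < 1 / x) :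
    partitionCount ν x ≤ S.card := by
  obtain ⟨n, hn⟩ := Nat.exists_eq_add_one.2 (Finset.card_pos.2 ⟨0, hS_zero⟩)
  set c := S.orderEmbOfFin hn
  have hmem (i : Fin (n + 1)) : c i ∈ S := Finset.orderEmbOfFin_mem S hn i
  have hsurj : ∀ s ∈ S, ∃ i, c i = s := fun _ hs =>
    (Finset.range_orderEmbOfFin S hn).symm.subset hs
  have hmono : StrictMono c := c.strictMono
  have hc_zero : c 0 = 0 := by
    obtain ⟨i, hi⟩ := hsurj 0 hS_zero
    exact le_antisymm (hi ▸ hmono.monotone (Fin.zero_le i)) (hS (hmem 0)).1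
  have hc_last : c (Fin.last n) = 1 := by
    obtain ⟨i, hi⟩ := hsurj 1 hS_one
    exact le_antisymm (hS (hmem _)).2 (hi ▸ hmono.monotone (Fin.le_last i))
  have hcount := partitionCount_le_of_strictMono h0 h1 hmono hc_zero hc_last fun k =>
    hgap _ (hmem _) _ (hmem _) (hmono Fin.castSucc_lt_succ) fun s hs => by
      obtain ⟨i, rfl⟩ := hsurj s hs
      rw [hmono.le_iff_le, hmono.le_iff_le, ← Fin.castSucc_lt_iff_succ_le]
      exact le_or_gt i k.castSucc
  exact hcount.trans (by rw [hn]; exact_mod_cast n.le_succ)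

end Partition

/-! ### The dyadic stopping partition -/

theorem exists_dyadic_of_forall_midpoint {a b : ℝ} (ha : 0 ≤ a) (hb : b ≤ 1) {L : ℕ}
    (hmid : ∀ n < L, ∀ k : ℕ, k < 2 ^ n → (k : ℝ) / 2 ^ n ≤ a → b ≤ ((k : ℝ) + 1) / 2 ^ n →
      (2 * (k : ℝ) + 1) / 2 ^ (n + 1) ≤ a ∨ b ≤ (2 * (k : ℝ) + 1) / 2 ^ (n + 1)) :
    ∃ k : ℕ, k < 2 ^ L ∧ (k : ℝ) / 2 ^ L ≤ a ∧ b ≤ ((k : ℝ) + 1) / 2 ^ L := by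
  induction L with
  | zero => exact ⟨0, by simp, by simpa using ha, by simpa using hb⟩
  | succ L ih =>
    obtain ⟨k, hk, hka, hbk⟩ := ih fun n hn => hmid n (hn.trans L.lt_succ_self)
    have hleft : (k : ℝ) / 2 ^ L = (2 * k) / 2 ^ (L + 1) := by
      rw [pow_succ]
      field_simp
    have hright : ((k : ℝ) + 1) / 2 ^ L = (2 * k + 1 + 1) / 2 ^ (L + 1) := by
      rw [pow_succ]
      field_simp
      ring
    rcases hmid L L.lt_succ_self k hk hka hbk with hle | hle
    · exact ⟨2 * k + 1, by omega, by exact_mod_cast hle, by push_cast; exact hright ▸ hbk⟩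
    · exact ⟨2 * k, by omega, by push_cast; exact hleft ▸ hka, by exact_mod_cast hle⟩

open Classical in
/-- The indices of the dyadic intervals `C` of level `n` with `ν(C) Λ(C) ≥ 1/x`. -/
def heavySet (ν : Measure ℝ) (x : ℝ) (n : ℕ) : Finset ℕ :=
  (Finset.range (2 ^ n)).filter fun k => 1 / x ≤ ν.real (dyadic n k) / 2 ^ n

theorem mem_heavySet {ν : Measure ℝ} {x : ℝ} {n k : ℕ} :
    k ∈ heavySet ν x n ↔ k < 2 ^ n ∧ 1 / x ≤ ν.real (dyadic n k) / 2 ^ n := by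
  simp [heavySet]

open Classical in
/-- The midpoints of the heavy dyadic intervals of level less than `L`, and the points `0`, `1`:
the cut points obtained by halving dyadic intervals as long as they are heavy. -/
def heavyCuts (ν : Measure ℝ) (x : ℝ) (L : ℕ) : Finset ℝ :=
  {0, 1} ∪ (Finset.range L).biUnion fun n =>
    (heavySet ν x n).image fun k : ℕ => (2 * (k : ℝ) + 1) / 2 ^ (n + 1)

theorem midpoint_mem_heavyCuts {ν : Measure ℝ} {x : ℝ} {L n k : ℕ} (hn : n < L)
    (hk : k ∈ heavySet ν x n) : (2 * (k : ℝ) + 1) / 2 ^ (n + 1) ∈ heavyCuts ν x L :=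
  Finset.mem_union_right _ (Finset.mem_biUnion.2
    ⟨n, Finset.mem_range.2 hn, Finset.mem_image_of_mem _ hk⟩)

theorem card_heavyCuts_le (ν : Measure ℝ) (x : ℝ) (L : ℕ) :
    (heavyCuts ν x L).card ≤ 2 + ∑ n ∈ Finset.range L, (heavySet ν x n).card :=
  (Finset.card_union_le _ _).trans (Nat.add_le_add Finset.card_le_two
    (Finset.card_biUnion_le.trans (Finset.sum_le_sum fun _ _ => Finset.card_image_le)))

theorem heavyCuts_subset_Icc (ν : Measure ℝ) (x : ℝ) (L : ℕ) :
    ↑(heavyCuts ν x L) ⊆ Icc (0 : ℝ) 1 := by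
  intro c hc
  simp only [heavyCuts, Finset.mem_coe, Finset.mem_union, Finset.mem_insert,
    Finset.mem_singleton, Finset.mem_biUnion, Finset.mem_image] at hc
  rcases hc with (rfl | rfl) | ⟨n, -, k, hk, rfl⟩
  · simp
  · simp
  · have hk_le : (k : ℝ) + 1 ≤ 2 ^ n := by exact_mod_cast (mem_heavySet.1 hk).1
    refine ⟨by positivity, (div_le_one (by positivity)).2 ?_⟩
    rw [pow_succ]
    linarith

section Stopping

variable {ν : Measure ℝ} {x : ℝ}

theorem partitionCount_le_sum_heavySet [IsFiniteMeasure ν] (h0 : ν {0} = 0) (h1 : ν {1} = 0) {L : ℕ}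
    (hL : ν.real univ / 2 ^ L < 1 / x) :
    partitionCount ν x ≤ ((2 + ∑ n ∈ Finset.range L, (heavySet ν x n).card : ℕ) : ℕ∞) := by
  refine (partitionCount_le_card (S := heavyCuts ν x L) h0 h1 (by simp [heavyCuts])
    (by simp [heavyCuts]) (heavyCuts_subset_Icc ν x L) fun a ha b hb hab hcut => ?_).trans
    (by exact_mod_cast card_heavyCuts_le ν x L)
  by_contra! hJ
  have hheavy (n k : ℕ) (hk : k < 2 ^ n) (hka : (k : ℝ) / 2 ^ n ≤ a)
      (hbk : b ≤ ((k : ℝ) + 1) / 2 ^ n) : k ∈ heavySet ν x n := by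
    refine mem_heavySet.2 ⟨hk, hJ.trans ?_⟩
    have hlen : b - a ≤ (2 ^ n : ℝ)⁻¹ := by
      rw [add_div, one_div] at hbk
      linarith
    rw [div_eq_mul_inv]
    exact mul_le_mul (measureReal_mono (Ioc_subset_Ioc hka hbk)) hlen (by linarith)
      measureReal_nonneg
  obtain ⟨k, hk, hka, hbk⟩ := exists_dyadic_of_forall_midpoint
    (heavyCuts_subset_Icc ν x L ha).1 (heavyCuts_subset_Icc ν x L hb).2 fun n hn k hk hka hbk =>
      hcut _ (midpoint_mem_heavyCuts hn (hheavy n k hk hka hbk))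
  have hlight : ν.real (dyadic L k) / 2 ^ L ≤ ν.real univ / 2 ^ L :=
    div_le_div_of_nonneg_right (measureReal_mono (subset_univ _)) (by positivity)
  exact ((mem_heavySet.1 (hheavy L k hk hka hbk)).2.trans hlight).not_gt hL

theorem card_heavySet_le_two_pow (ν : Measure ℝ) (x : ℝ) (n : ℕ) :
    (heavySet ν x n).card ≤ 2 ^ n := by
  simpa [heavySet] using Finset.card_filter_le (Finset.range (2 ^ n)) _

theorem card_heavySet_le_rpow {q : ℝ} (hq : 0 ≤ q) (hx : 0 < x) {n : ℕ}
    (hsum : dyadicSum ν n q ≤ 1) : ((heavySet ν x n).card : ℝ) ≤ x ^ q := by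
  have hsub : heavySet ν x n ⊆ charged ν n := fun k hk => by
    obtain ⟨hk_lt, hk_le⟩ := mem_heavySet.1 hk
    refine mem_charged.2 ⟨hk_lt, pos_iff_ne_zero.2 fun hzero => ?_⟩
    rw [measureReal_def, hzero, ENNReal.toReal_zero, zero_div] at hk_le
    exact (one_div_pos.2 hx).not_ge hk_le
  have hcard : (heavySet ν x n).card * (1 / x) ^ q ≤ 1 :=
    calc (heavySet ν x n).card * (1 / x) ^ q
        ≤ ∑ k ∈ heavySet ν x n, (ν.real (dyadic n k) / 2 ^ n) ^ q := by
          rw [← nsmul_eq_mul]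
          refine Finset.card_nsmul_le_sum _ _ _ fun k hk => ?_
          exact Real.rpow_le_rpow (by positivity) (mem_heavySet.1 hk).2 hq
      _ ≤ dyadicSum ν n q :=
          Finset.sum_le_sum_of_subset_of_nonneg hsub fun k _ _ => by positivity
      _ ≤ 1 := hsum
  rwa [one_div, Real.inv_rpow hx.le, ← div_eq_mul_inv, div_le_one (by positivity)] at hcard

variable [IsFiniteMeasure ν]

theorem eventually_card_heavySet_le_rpow (hν : ν (Ioc 0 1) ≠ 0) {q : ℝ}
    (hq : upperFixedPoint ν < (q : EReal)) :
    ∀ᶠ x : ℝ in atTop, ∀ n, ((heavySet ν x n).card : ℝ) ≤ x ^ q := by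
  have hq_pos : 0 < q := by exact_mod_cast (upperFixedPoint_nonneg hν).trans_lt hq
  obtain ⟨n₀, hn₀⟩ := eventually_atTop.1 (eventually_dyadicSum_lt_one hν hq)
  filter_upwards [eventually_gt_atTop 0, (tendsto_rpow_atTop hq_pos).eventually_ge_atTop (2 ^ n₀)]
    with x hx hxn₀ n
  rcases le_total n₀ n with hn | hn
  · exact card_heavySet_le_rpow hq_pos.le hx (hn₀ n hn).le
  · refine le_trans ?_ hxn₀
    exact_mod_cast (card_heavySet_le_two_pow ν x n).trans (Nat.pow_le_pow_right two_pos hn)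

theorem eventually_mul_lt_two_rpow_rpow (c : ℝ) {ε : ℝ} (hε : 0 < ε) :
    ∀ᶠ x : ℝ in atTop, c * x < 2 ^ x ^ ε := by
  have hlittle := (isLittleO_rpow_exp_pos_mul_atTop (1 / ε) (Real.log_pos one_lt_two)).comp_tendsto
    (tendsto_rpow_atTop hε)
  have hconst : 0 < (|c| + 1)⁻¹ := by positivity
  filter_upwards [hlittle.bound hconst, eventually_gt_atTop 0] with x hbound hx
  simp only [Function.comp_apply, ← Real.rpow_mul hx.le, mul_one_div_cancel hε.ne',
    Real.rpow_one, ← Real.rpow_def_of_pos two_pos] at hbound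
  rw [Real.norm_of_nonneg hx.le, Real.norm_of_nonneg (by positivity), inv_mul_eq_div,
    le_div_iff₀ (by positivity)] at hbound
  nlinarith [le_abs_self c]

/-- With `L = ⌈x^ε⌉` levels the halving procedure reaches intervals that are not heavy, and each
level contributes at most `x^q` cut points. -/
theorem upperEntropy_le_upperFixedPoint (h0 : ν {0} = 0) (h1 : ν {1} = 0)
    (hν : ν (Ioc 0 1) ≠ 0) : upperEntropy ν ≤ upperFixedPoint ν := by
  refine EReal.le_of_forall_lt_iff_le.1 fun s hs => ?_
  obtain ⟨q, hq, hqs⟩ := EReal.lt_iff_exists_real_btwn.1 hs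
  have hq_pos : 0 < q := by exact_mod_cast (upperFixedPoint_nonneg hν).trans_lt hq
  obtain ⟨ε, hε, rfl⟩ : ∃ ε > 0, s = q + 2 * ε :=
    ⟨(s - q) / 2, half_pos (sub_pos.2 (by exact_mod_cast hqs)), by ring⟩
  refine limsup_le_of_le (by isBoundedDefault) ?_
  filter_upwards [eventually_card_heavySet_le_rpow hν hq,
    eventually_mul_lt_two_rpow_rpow (ν.real univ) hε, eventually_gt_atTop 1,
    (tendsto_rpow_atTop hε).eventually_ge_atTop 4] with x hheavy hmass hx hx_four
  have hx_pos : 0 < x := one_pos.trans hx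
  set L := ⌈x ^ ε⌉₊
  have hL : ν.real univ / 2 ^ L < 1 / x := by
    rw [div_lt_div_iff₀ (by positivity) hx_pos, one_mul, ← Real.rpow_natCast]
    exact hmass.trans_le (Real.rpow_le_rpow_of_exponent_le one_le_two (Nat.le_ceil _))
  have hcount : ((2 + ∑ n ∈ Finset.range L, (heavySet ν x n).card : ℕ) : ℝ) ≤
      x ^ (q + 2 * ε) := by
    have hxq : 1 ≤ x ^ q := Real.one_le_rpow hx.le hq_pos.le
    calc ((2 + ∑ n ∈ Finset.range L, (heavySet ν x n).card : ℕ) : ℝ)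
        ≤ 2 + ∑ _n ∈ Finset.range L, x ^ q := by
          push_cast
          gcongr with n
          exact hheavy n
      _ = 2 + L * x ^ q := by rw [Finset.sum_const, Finset.card_range, nsmul_eq_mul]
      _ ≤ 2 + (x ^ ε + 1) * x ^ q := by
          gcongr
          exact (Nat.ceil_lt_add_one (by positivity)).le
      _ ≤ x ^ q * (x ^ ε * x ^ ε) := by
          have hsq : x ^ ε + 3 ≤ x ^ ε * x ^ ε := by nlinarith
          nlinarith [mul_le_mul_of_nonneg_left hsq (one_pos.le.trans hxq)]
      _ = x ^ (q + 2 * ε) := by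
          rw [← Real.rpow_add hx_pos, ← Real.rpow_add hx_pos, two_mul]
  exact logRatio_le_of_le_rpow hx (partitionCount_le_sum_heavySet h0 h1 hL) hcount

end Stopping

/-! ### The reduced counts and the coarse multifractal dimensions -/

theorem rpow_le_coarseCount_of_lt_coarseRatio {ν : Measure ℝ} {α s : ℝ} {n : ℕ} (hs : 0 ≤ s)
    (hn : n ≠ 0) (hlt : s < coarseRatio ν α n) : ((2 : ℝ) ^ n) ^ s ≤ coarseCount ν α n := by
  contrapose! hlt
  rw [coarseRatio, div_le_iff₀ (log_two_pow_pos hn)]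
  calc Real.posLog (coarseCount ν α n)
      ≤ Real.posLog ((2 ^ n) ^ s) := Real.posLog_le_posLog (Nat.cast_nonneg _) hlt.le
    _ = s * Real.log (2 ^ n) := by
        rw [Real.posLog_eq_log, Real.log_rpow (by positivity)]
        exact (Real.one_le_rpow (one_le_pow₀ one_le_two) hs).trans (le_abs_self _)

theorem centered_sub_add (m c R : ℝ) :
    centered m (c - R) (c + R) = Icc (c - R / m) (c + R / m) := by
  rw [centered, add_sub_sub_cancel, ← two_mul R, mul_div_mul_left _ _ two_ne_zero,
    sub_add_add_cancel, add_self_div_two]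

theorem exists_radius_not_atom (ν : Measure ℝ) [SFinite ν] (c : ℝ) {a b : ℝ} (hab : a < b) :
    ∃ R ∈ Ioo a b, ν {c - R} = 0 ∧ ν {c + R} = 0 := by
  have hcount : ({R | ν {c - R} ≠ 0} ∪ {R | ν {c + R} ≠ 0}).Countable :=
    (countable_atoms.preimage sub_right_injective).union
      (countable_atoms.preimage (add_right_injective c))
  obtain ⟨R, hR, hR_mem⟩ := (hcount.dense_compl ℝ).exists_between hab
  simp only [mem_compl_iff, mem_union, mem_ofPred_eq, not_or, not_not] at hR
  exact ⟨R, hR_mem, hR⟩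

theorem card_le_reducedCount {ι : Type*} [LinearOrder ι] {ν : Measure ℝ} {m x : ℝ} {A : Finset ι}
    {l r : ι → ℝ} (hl : ∀ k ∈ A, 0 ≤ l k) (hlr : ∀ k ∈ A, l k < r k) (hr : ∀ k ∈ A, r k ≤ 1)
    (hl_atom : ∀ k ∈ A, ν {l k} = 0) (hr_atom : ∀ k ∈ A, ν {r k} = 0)
    (hsep : ∀ k ∈ A, ∀ j ∈ A, k < j → r k ≤ l j)
    (hmass : ∀ k ∈ A, 4 / (x * (m - 1)) ≤
      ν.real (centered m (l k) (r k)) * volume.real (centered m (l k) (r k))) :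
    (A.card : ℕ∞) ≤ reducedCount ν m x := by
  classical
  have hmono : StrictMonoOn l A := fun k hk j hj hkj => (hlr k hk).trans_le (hsep k hk j hj hkj)
  have hinj : InjOn (fun k => (l k, r k)) A := fun k hk j hj hkj =>
    hmono.injOn hk hj (congrArg Prod.fst hkj)
  refine le_sSup ⟨A.image fun k => (l k, r k), by rw [Finset.card_image_of_injOn hinj],
    ⟨?_, ?_⟩, ?_⟩
  · simp only [Finset.forall_mem_image]
    exact fun k hk => ⟨hl k hk, hlr k hk, hr k hk, hl_atom k hk, hr_atom k hk⟩
  · rw [Finset.coe_image, hinj.pairwiseDisjoint_image]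
    intro k hk j hj hkj
    rcases hkj.lt_or_gt with hlt | hlt
    · exact Ioc_disjoint_Ioc_of_le (hsep k hk j hj hlt)
    · exact (Ioc_disjoint_Ioc_of_le (hsep j hj k hk hlt)).symm
  · simpa only [Finset.forall_mem_image] using hmass

section Reduced

variable {ν : Measure ℝ} [IsFiniteMeasure ν] {m x α t z : ℝ} {n N : ℕ}

theorem eventually_one_le_reducedCount (hν : ν (Ioo 0 1) ≠ 0) (hm : 1 < m) :
    ∀ᶠ x in atTop, 1 ≤ reducedCount ν m x := by
  obtain ⟨y, hy, hy_pos⟩ := exists_mem_forall_mem_nhdsWithin_pos_measure hν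
  obtain ⟨R, hR, hl_atom, hr_atom⟩ := exists_radius_not_atom ν y (lt_min hy.1 (sub_pos.2 hy.2))
  obtain ⟨hRy, hRy'⟩ := lt_min_iff.1 hR.2
  have hRm : 0 < R / m := div_pos hR.1 (by linarith)
  have hmass : 0 < ν.real (centered m (y - R) (y + R)) *
      volume.real (centered m (y - R) (y + R)) := by
    rw [centered_sub_add, Real.volume_real_Icc_of_le (by linarith)]
    refine mul_pos (ENNReal.toReal_pos (hy_pos _ ?_).ne' (measure_ne_top _ _)) (by linarith)
    exact mem_nhdsWithin_of_mem_nhds (Icc_mem_nhds (by linarith) (by linarith))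
  have hlim : Tendsto (fun x : ℝ => 4 / (x * (m - 1))) atTop (nhds 0) :=
    tendsto_const_nhds.div_atTop (tendsto_id.atTop_mul_const (by linarith))
  filter_upwards [hlim.eventually (gt_mem_nhds hmass)] with x hx
  have hcard := card_le_reducedCount (ν := ν) (m := m) (x := x) (A := {()})
    (l := fun _ => y - R) (r := fun _ => y + R) (fun _ _ => by linarith)
    (fun _ _ => by linarith [hR.1]) (fun _ _ => by linarith) (fun _ _ => hl_atom)
    (fun _ _ => hr_atom) (fun _ _ _ _ hlt => absurd hlt (lt_irrefl _)) (fun _ _ => hx.le)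
  simpa using hcard

/-- Each dyadic interval is enlarged to one with the same centre and with length between `m` and
`N` times its own, so that its `m`-reduction still contains the dyadic interval; the enlarged
intervals of a residue class modulo `N` are disjoint. -/
theorem card_le_reducedCount_of_residue (hm : 0 < m) (hmN : m < N)
    (hx : 4 / (x * (m - 1)) ≤ (2 ^ n) ^ (-α) / 2 ^ n) {A : Finset ℕ} (hA : A ⊆ coarseSet ν α n)
    (hleft : ∀ k ∈ A, N ≤ k) (hright : ∀ k ∈ A, k + N ≤ 2 ^ n)
    (hmod : ∀ k ∈ A, ∀ j ∈ A, k ≡ j [MOD N]) : (A.card : ℕ∞) ≤ reducedCount ν m x := by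
  set u : ℝ := 1 / 2 ^ n with hu
  have hu_pos : 0 < u := by positivity
  have hu_mul : (2 : ℝ) ^ n * u = 1 := mul_one_div_cancel (by positivity)
  have hone_lt : (1 : ℝ) ≤ N := by
    have : 0 < N := by exact_mod_cast hm.trans hmN
    exact_mod_cast this
  choose R hR hl_atom hr_atom using fun k : ℕ =>
    exists_radius_not_atom ν ((k + 1 / 2) * u) (mul_lt_mul_of_pos_right
      (div_lt_div_of_pos_right hmN two_pos) hu_pos)
  have hR_pos (k : ℕ) : 0 < R k := (by positivity : 0 < m / 2 * u).trans (hR k).1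
  refine card_le_reducedCount (l := fun k : ℕ => (k + 1 / 2) * u - R k)
    (r := fun k : ℕ => (k + 1 / 2) * u + R k) (fun k hk => ?_) (fun k _ => by linarith [hR_pos k])
    (fun k hk => ?_) (fun k _ => hl_atom k) (fun k _ => hr_atom k) (fun k hk j hj hkj => ?_)
    (fun k hk => ?_)
  · have hNk : (N : ℝ) ≤ k := by exact_mod_cast hleft k hk
    nlinarith [(hR k).2]
  · have hkN : (k : ℝ) + N ≤ 2 ^ n := by exact_mod_cast hright k hk
    nlinarith [(hR k).2]
  · have hgap : (k : ℝ) + N ≤ j := by exact_mod_cast (hmod k hk j hj).add_le_of_lt hkj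
    nlinarith [(hR k).2, (hR j).2]
  · have hradius : 1 / 2 * u ≤ R k / m := by
      rw [le_div_iff₀ hm]
      linarith [(hR k).1]
    have hsub : dyadic n k ⊆ Icc ((k + 1 / 2) * u - R k / m) ((k + 1 / 2) * u + R k / m) := by
      rw [dyadic, div_eq_mul_one_div, div_eq_mul_one_div ((k : ℝ) + 1), ← hu]
      exact Ioc_subset_Icc_self.trans (Icc_subset_Icc (by linarith) (by linarith))
    rw [centered_sub_add, Real.volume_real_Icc_of_le (by linarith)]
    refine hx.trans ?_
    rw [div_eq_mul_one_div _ ((2 : ℝ) ^ n), ← hu]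
    exact mul_le_mul ((mem_coarseSet.1 (hA hk)).2.trans (measureReal_mono hsub)) (by linarith)
      hu_pos.le measureReal_nonneg

theorem coarseCount_le_reducedCount (hm : 0 < m) (hmN : m < N)
    (hx : 4 / (x * (m - 1)) ≤ (2 ^ n) ^ (-α) / 2 ^ n) :
    (coarseCount ν α n : ℕ∞) ≤ 2 * N + N * reducedCount ν m x := by
  classical
  have hN : 0 < N := by exact_mod_cast hm.trans hmN
  set inner := (coarseSet ν α n).filter fun k => N ≤ k ∧ k + N ≤ 2 ^ n
  have houter : ((coarseSet ν α n).filter fun k => ¬ (N ≤ k ∧ k + N ≤ 2 ^ n)).card ≤ 2 * N := by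
    calc _ ≤ (Finset.range N ∪ Finset.Ico (2 ^ n - N) (2 ^ n)).card := by
          refine Finset.card_le_card fun k hk => ?_
          obtain ⟨hk_mem, hk⟩ := Finset.mem_filter.1 hk
          have := (mem_coarseSet.1 hk_mem).1
          simp only [Finset.mem_union, Finset.mem_range, Finset.mem_Ico]
          omega
      _ ≤ _ := Finset.card_union_le _ _
      _ ≤ 2 * N := by
          rw [Finset.card_range, Nat.card_Ico]
          omega
  have hresidue (i : ℕ) : ((inner.filter fun k => k % N = i).card : ℕ∞) ≤ reducedCount ν m x := by
    refine card_le_reducedCount_of_residue hm hmN hx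
      ((Finset.filter_subset _ _).trans (Finset.filter_subset _ _)) ?_ ?_ ?_
    · exact fun k hk => (Finset.mem_filter.1 (Finset.mem_filter.1 hk).1).2.1
    · exact fun k hk => (Finset.mem_filter.1 (Finset.mem_filter.1 hk).1).2.2
    · exact fun k hk j hj => (Finset.mem_filter.1 hk).2.trans (Finset.mem_filter.1 hj).2.symm
  have hinner : (inner.card : ℕ∞) ≤ N * reducedCount ν m x := by
    rw [Finset.card_eq_sum_card_fiberwise (t := Finset.range N) fun k _ =>
      Finset.mem_coe.2 (Finset.mem_range.2 (Nat.mod_lt k hN)), Nat.cast_sum]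
    refine (Finset.sum_le_sum fun i _ => hresidue i).trans_eq ?_
    rw [Finset.sum_const, Finset.card_range, nsmul_eq_mul]
  rw [← card_coarseSet, ← Finset.card_filter_add_card_filter_not
    (s := coarseSet ν α n) (fun k => N ≤ k ∧ k + N ≤ 2 ^ n), Nat.cast_add, add_comm]
  exact add_le_add (by exact_mod_cast houter) hinner

theorem eventually_rpow_le_reducedCount (hm : 1 < m) {κ : ℝ} (hκ : 0 < κ) (hz : 0 ≤ z)
    (hzt : z < t) (α : ℝ) :
    ∀ᶠ x in atTop, ∀ n : ℕ, ((2 : ℝ) ^ n) ^ (1 + α) ≤ x * (m - 1) / 4 →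
      κ * x ≤ (2 ^ n) ^ (1 + α) → (2 ^ n) ^ (t * (1 + α)) ≤ (coarseCount ν α n : ℝ) →
        ENNReal.ofReal (x ^ z) ≤ (reducedCount ν m x : ℝ≥0∞) := by
  obtain ⟨N, hmN⟩ := exists_nat_gt m
  have hlarge : ∀ᶠ x : ℝ in atTop, 3 * N ≤ κ ^ t * x ^ (t - z) :=
    ((tendsto_rpow_atTop (sub_pos.2 hzt)).const_mul_atTop
      (Real.rpow_pos_of_pos hκ t)).eventually_ge_atTop _
  filter_upwards [hlarge, eventually_gt_atTop 1] with x hlarge hx n hle hge hcount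
  have hx_pos : 0 < x := by linarith
  have hthreshold : 4 / (x * (m - 1)) ≤ (2 ^ n) ^ (-α) / 2 ^ n := by
    rw [show ((2 : ℝ) ^ n) ^ (-α) / 2 ^ n = 1 / (2 ^ n) ^ (1 + α) by
      rw [Real.rpow_add (by positivity), Real.rpow_one, Real.rpow_neg (by positivity)]
      field_simp, div_le_div_iff₀ (mul_pos hx_pos (by linarith)) (by positivity)]
    linarith
  have hbound := coarseCount_le_reducedCount (ν := ν) (by linarith) hmN hthreshold
  rcases eq_or_ne (reducedCount ν m x) ⊤ with htop | htop
  · rw [htop]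
    simp
  lift reducedCount ν m x to ℕ using htop with r
  have hbound : (coarseCount ν α n : ℝ) ≤ 2 * N + N * r := by exact_mod_cast hbound
  have hpow : κ ^ t * x ^ (t - z) * x ^ z ≤ coarseCount ν α n := by
    calc κ ^ t * x ^ (t - z) * x ^ z = (κ * x) ^ t := by
          rw [mul_assoc, ← Real.rpow_add hx_pos, sub_add_cancel, Real.mul_rpow hκ.le hx_pos.le]
      _ ≤ ((2 ^ n) ^ (1 + α)) ^ t := by gcongr; linarith
      _ = (2 ^ n) ^ (t * (1 + α)) := by rw [← Real.rpow_mul (by positivity), mul_comm]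
      _ ≤ coarseCount ν α n := hcount
  have hone : 1 ≤ x ^ z := Real.one_le_rpow hx.le hz
  have hfinal : x ^ z ≤ r := by nlinarith
  rw [ENat.toENNReal_coe, ← ENNReal.ofReal_natCast]
  exact ENNReal.ofReal_le_ofReal hfinal

theorem lowerReducedEntropy_nonneg (hν : ν (Ioo 0 1) ≠ 0) (hm : 1 < m) :
    0 ≤ lowerReducedEntropy ν m := by
  refine le_liminf_of_le (by isBoundedDefault) ?_
  filter_upwards [eventually_one_le_reducedCount hν hm, eventually_gt_atTop 1] with x hone hx
  exact_mod_cast le_logRatio_of_rpow_le (t := 0) hx (by simpa using ENat.toENNReal_le.2 hone)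

theorem div_le_of_forall_mul_lt {L U : EReal} {c : ℝ} (hc : 0 < c) (hU : 0 ≤ U)
    (h : ∀ z t : ℝ, 0 ≤ z → z < t → ((t * c : ℝ) : EReal) < L → (z : EReal) ≤ U) :
    L / (c : EReal) ≤ U := by
  refine EReal.ge_of_forall_gt_iff_ge.1 fun z hz => ?_
  rcases lt_or_ge z 0 with hz_neg | hz_nonneg
  · exact (by exact_mod_cast hz_neg.le : (z : EReal) ≤ 0).trans hU
  obtain ⟨t, hzt, ht⟩ := EReal.lt_iff_exists_real_btwn.1 hz
  rw [EReal.lt_div_iff (by exact_mod_cast hc) (EReal.coe_ne_top _), ← EReal.coe_mul] at ht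
  exact h z t hz_nonneg (by exact_mod_cast hzt) ht

theorem exists_tendsto_two_pow_rpow {a : ℝ} (ha : 0 < a) :
    ∃ f : ℝ → ℕ, Tendsto f atTop atTop ∧
      ∀ y, 1 ≤ y → ((2 : ℝ) ^ f y) ^ a ≤ y ∧ y ≤ 2 ^ a * (2 ^ f y) ^ a := by
  have hb : (1 : ℝ) < 2 ^ a := Real.one_lt_rpow one_lt_two ha
  have hpow (k : ℕ) : ((2 : ℝ) ^ k) ^ a = (2 ^ a) ^ (k : ℝ) := by
    rw [two_pow_rpow, ← Real.rpow_mul zero_le_two]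
  refine ⟨fun y => ⌊Real.logb (2 ^ a) y⌋₊,
    tendsto_nat_floor_atTop.comp (Real.tendsto_logb_atTop hb), fun y hy => ⟨?_, ?_⟩⟩
  · rw [hpow, ← Real.le_logb_iff_rpow_le hb (by linarith)]
    exact Nat.floor_le (Real.logb_nonneg hb hy)
  · rw [hpow, ← Real.rpow_one_add' (by positivity) (by positivity),
      ← Real.logb_le_iff_le_rpow hb (by linarith), add_comm]
    exact (Nat.lt_floor_add_one _).le

theorem lowerCoarseDim_le_lowerReducedEntropy (hν : ν (Ioo 0 1) ≠ 0) (hm : 1 < m) :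
    lowerCoarseDim ν ≤ lowerReducedEntropy ν m := by
  refine iSup₂_le fun α hα => ?_
  have hα_pos : 0 < 1 + α := by linarith
  refine div_le_of_forall_mul_lt hα_pos (lowerReducedEntropy_nonneg hν hm) fun z t hz hzt ht => ?_
  have hcount : ∀ᶠ n : ℕ in atTop, ((2 : ℝ) ^ n) ^ (t * (1 + α)) ≤ coarseCount ν α n := by
    filter_upwards [eventually_lt_of_lt_liminf ht, eventually_ne_atTop 0] with n hlt hn
    exact rpow_le_coarseCount_of_lt_coarseRatio (mul_nonneg (hz.trans hzt.le) hα_pos.le) hn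
      (by exact_mod_cast hlt)
  obtain ⟨f, hf, hscale⟩ := exists_tendsto_two_pow_rpow hα_pos
  have hκ : 0 < (m - 1) / 4 / 2 ^ (1 + α) := by
    have : 0 < m - 1 := by linarith
    positivity
  have hlin : Tendsto (fun x : ℝ => x * (m - 1) / 4) atTop atTop :=
    (tendsto_id.atTop_mul_const (by linarith)).atTop_div_const (by norm_num)
  refine le_liminf_of_le (by isBoundedDefault) ?_
  filter_upwards [eventually_gt_atTop 1, hlin.eventually (hf.eventually hcount),
    hlin.eventually_ge_atTop 1, eventually_rpow_le_reducedCount (ν := ν) hm hκ hz hzt α]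
    with x hx hn hx' hreduced
  obtain ⟨hle, hge⟩ := hscale _ hx'
  refine le_logRatio_of_rpow_le hx (hreduced _ hle ?_ hn)
  rw [div_mul_eq_mul_div, div_le_iff₀ (by positivity)]
  linarith

theorem upperCoarseDim_le_upperReducedEntropy (hν : ν (Ioo 0 1) ≠ 0) (hm : 1 < m) :
    upperCoarseDim ν ≤ upperReducedEntropy ν m := by
  refine iSup₂_le fun α hα => ?_
  have hα_pos : 0 < 1 + α := by linarith
  refine div_le_of_forall_mul_lt hα_pos ((lowerReducedEntropy_nonneg hν hm).trans
    (lowerExponent_le_upperExponent _)) fun z t hz hzt ht => ?_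
  set κ := (m - 1) / 4 with hκ
  have hκ_pos : 0 < κ := by
    have : 0 < m - 1 := by linarith
    positivity
  have hscale : Tendsto (fun n : ℕ => ((2 : ℝ) ^ n) ^ (1 + α) / κ) atTop atTop :=
    ((tendsto_rpow_atTop hα_pos).comp
      (tendsto_pow_atTop_atTop_of_one_lt one_lt_two)).atTop_div_const hκ_pos
  refine le_limsup_of_frequently_le (hscale.frequently ?_)
  refine ((frequently_lt_of_lt_limsup (by isBoundedDefault) ht).and_eventually
    ((eventually_ne_atTop 0).and (hscale.eventually ((eventually_gt_atTop 1).and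
      (eventually_rpow_le_reducedCount (ν := ν) hm hκ_pos hz hzt α))))).mono ?_
  rintro n ⟨hlt, hn, hone, hreduced⟩
  refine le_logRatio_of_rpow_le hone (hreduced n ?_ ?_ (rpow_le_coarseCount_of_lt_coarseRatio
    (mul_nonneg (hz.trans hzt.le) hα_pos.le) hn (by exact_mod_cast hlt)))
  · rw [mul_div_assoc, ← hκ, div_mul_cancel₀ _ hκ_pos.ne']
  · rw [mul_div_cancel₀ _ hκ_pos.ne']

end Reduced

/-! ### The variational principle for compact forms -/

section Variational

variable {H K : Type*} [NormedAddCommGroup H] [InnerProductSpace ℝ H]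
  [NormedAddCommGroup K] [InnerProductSpace ℝ K] {b : H →L[ℝ] K} {x : ℝ}

/-- The solutions of the generalized eigenvalue problem `⟪v, g⟫ = l ⟪b v, b g⟫`, for all `g`. -/
def formEigenspace (b : H →L[ℝ] K) (l : ℝ) : Submodule ℝ H where
  carrier := {v | ∀ g, inner ℝ v g = l * inner ℝ (b v) (b g)}
  zero_mem' g := by simp
  add_mem' {v w} hv hw g := by
    rw [inner_add_left, map_add, inner_add_left, hv g, hw g, mul_add]
  smul_mem' c v hv g := by
    rw [real_inner_smul_left, map_smul, real_inner_smul_left, hv g, mul_left_comm]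

/-- The eigenvectors of the generalized eigenvalue problem with eigenvalue at most `x`. -/
def formEigenvectors (b : H →L[ℝ] K) (x : ℝ) : Set H :=
  {v | v ≠ 0 ∧ ∃ l ≤ x, v ∈ formEigenspace b l}

theorem inner_map_map_eq_zero_of_mem_formEigenspace {l l' : ℝ} (hll' : l ≠ l') {v w : H}
    (hv : v ∈ formEigenspace b l) (hw : w ∈ formEigenspace b l') :
    inner ℝ (b v) (b w) = 0 := by
  have hvw : l * inner ℝ (b v) (b w) = l' * inner ℝ (b v) (b w) := by
    rw [← hv w, real_inner_comm, hw v, real_inner_comm]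
  exact (mul_eq_mul_right_iff.1 hvw).resolve_left hll'

theorem norm_sq_le_of_mem_span_formEigenvectors {u : H}
    (hu : u ∈ Submodule.span ℝ (formEigenvectors b x)) : ‖u‖ ^ 2 ≤ x * ‖b u‖ ^ 2 := by
  have span_le : Submodule.span ℝ (formEigenvectors b x) ≤
      ⨆ l : Iic x, formEigenspace b (l : ℝ) := by
    rw [Submodule.span_le]
    rintro v ⟨-, l, hl, hv⟩
    exact Submodule.mem_iSup_of_mem (p := fun l : Iic x => formEigenspace b (l : ℝ)) ⟨l, hl⟩ hv
  obtain ⟨f, hf, rfl⟩ := (Submodule.mem_iSup_iff_exists_finsupp _ _).1 (span_le hu)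
  have orthogonal : ∀ l l' : Iic x, l' ≠ l → inner ℝ (b (f l)) (b (f l')) = 0 := fun l l' hne =>
    inner_map_map_eq_zero_of_mem_formEigenspace (Subtype.coe_injective.ne hne.symm) (hf l) (hf l')
  have norm_sq_map : ‖b (∑ l ∈ f.support, f l)‖ ^ 2 = ∑ l ∈ f.support, ‖b (f l)‖ ^ 2 := by
    rw [← real_inner_self_eq_norm_sq, map_sum, sum_inner]
    refine Finset.sum_congr rfl fun l hl => ?_
    rw [inner_sum, Finset.sum_eq_single_of_mem l hl fun l' _ hne => orthogonal l l' hne,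
      real_inner_self_eq_norm_sq]
  have norm_sq : ‖∑ l ∈ f.support, f l‖ ^ 2 = ∑ l ∈ f.support, (l : ℝ) * ‖b (f l)‖ ^ 2 := by
    rw [← real_inner_self_eq_norm_sq, sum_inner]
    refine Finset.sum_congr rfl fun l hl => ?_
    rw [inner_sum, Finset.sum_eq_single_of_mem l hl fun l' _ hne => by
      rw [hf l (f l'), orthogonal l l' hne, mul_zero], hf l (f l), real_inner_self_eq_norm_sq]
  rw [Finsupp.sum, norm_sq_map, norm_sq, Finset.mul_sum]
  exact Finset.sum_le_sum fun l _ => mul_le_mul_of_nonneg_right l.2 (by positivity)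

theorem inner_map_map_eq_zero_of_mem_orthogonal {p v : H}
    (hp : p ∈ Submodule.span ℝ (formEigenvectors b x))
    (hv : v ∈ (Submodule.span ℝ (formEigenvectors b x))ᗮ) :
    inner ℝ (b p) (b v) = 0 := by
  induction hp using Submodule.span_induction with
  | mem p hp =>
    have inner_eq_zero : inner ℝ p v = 0 := hv p (Submodule.subset_span hp)
    obtain ⟨hp0, l, -, hl⟩ := hp
    have hl0 : l ≠ 0 := by
      rintro rfl
      exact hp0 (by simpa using hl p)
    exact (mul_eq_zero.1 ((hl v).symm.trans inner_eq_zero)).resolve_left hl0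
  | zero => rw [map_zero, inner_zero_left]
  | add p q _ _ hp hq => rw [map_add, inner_add_left, hp, hq, add_zero]
  | smul c p _ hp => rw [map_smul, real_inner_smul_left, hp, mul_zero]

theorem exists_ne_zero_mem_orthogonal_of_finrank_lt {V W : Submodule ℝ H} [FiniteDimensional ℝ V]
    [FiniteDimensional ℝ W] (hVW : Module.finrank ℝ V < Module.finrank ℝ W) :
    ∃ w ∈ W, w ∈ Vᗮ ∧ w ≠ 0 := by
  obtain ⟨w, hw, hw0⟩ := (Submodule.ne_bot_iff _).1 (LinearMap.ker_ne_bot_of_finrank_lt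
    (f := (V.orthogonalProjectionOnto : H →ₗ[ℝ] V) ∘ₗ W.subtype) hVW)
  rw [LinearMap.mem_ker, LinearMap.comp_apply] at hw
  exact ⟨w, w.2, Submodule.orthogonalProjectionOnto_eq_zero_iff.1 hw, by simpa using hw0⟩

variable [CompleteSpace H]

theorem exists_eigenvector_norm {T : H →L[ℝ] H} (hT : IsCompactOperator T)
    (hsymm : T.IsSymmetric) (hpos : ∀ v, 0 ≤ inner ℝ (T v) v) (hT0 : T ≠ 0) :
    ∃ v, v ≠ 0 ∧ T v = ‖T‖ • v := by
  have radius_eq := T.spectralRadius_eq_nnnorm hsymm.isSelfAdjoint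
  have spectrum_nonempty : (spectrum ℝ T).Nonempty := by
    by_contra hempty
    rw [spectralRadius, Set.not_nonempty_iff_eq_empty.1 hempty] at radius_eq
    exact hT0 (by simpa using radius_eq.symm)
  obtain ⟨μ, hμ, hμ_radius⟩ :=
    spectrum.exists_nnnorm_eq_spectralRadius_of_nonempty spectrum_nonempty
  have abs_eq : |μ| = ‖T‖ :=
    congrArg NNReal.toReal (ENNReal.coe_injective (hμ_radius.trans radius_eq))
  have hμ0 : μ ≠ 0 := fun h => hT0 (by simpa [h] using abs_eq.symm)
  obtain ⟨v, hv⟩ := ((hT.hasEigenvalue_iff_mem_spectrum hμ0).2 hμ).exists_hasEigenvector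
  have apply_v : T v = μ • v := hv.apply_eq_smul
  have hμ_nonneg : 0 ≤ μ := by
    have h := hpos v
    rw [apply_v, real_inner_smul_left, real_inner_self_eq_norm_sq] at h
    exact nonneg_of_mul_nonneg_left h (pow_pos (norm_pos_iff.2 hv.2) 2)
  exact ⟨v, hv.2, by rw [← abs_eq, abs_of_nonneg hμ_nonneg, apply_v]⟩

variable [CompleteSpace K]

theorem formEigenvectors_nonempty (hb : IsCompactOperator b) (hx : 0 < x) {w : H} (hw0 : w ≠ 0)
    (hw : ‖w‖ ^ 2 ≤ x * ‖b w‖ ^ 2) : (formEigenvectors b x).Nonempty := by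
  set T : H →L[ℝ] H := b.adjoint ∘L b with T_def
  have inner_T : ∀ u g, inner ℝ (T u) g = inner ℝ (b u) (b g) := fun u g => by
    rw [T_def, ContinuousLinearMap.comp_apply, ContinuousLinearMap.adjoint_inner_left]
  have T_symm : T.IsSymmetric := fun u g => by
    change inner ℝ (T u) g = inner ℝ u (T g)
    rw [inner_T, real_inner_comm, ← inner_T, real_inner_comm]
  have norm_sq_map_le : ‖b w‖ ^ 2 ≤ ‖T‖ * ‖w‖ ^ 2 := by
    rw [← real_inner_self_eq_norm_sq, ← inner_T, sq, ← mul_assoc]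
    exact (real_inner_le_norm _ _).trans (by gcongr; exact T.le_opNorm w)
  have one_le : 1 ≤ x * ‖T‖ := by
    refine le_of_mul_le_mul_right ?_ (pow_pos (norm_pos_iff.2 hw0) 2)
    rw [one_mul, mul_assoc]
    exact hw.trans (by gcongr)
  have norm_pos : 0 < ‖T‖ := pos_of_mul_pos_right (one_pos.trans_le one_le) hx.le
  obtain ⟨v, hv0, hv⟩ := exists_eigenvector_norm (hb.clm_comp b.adjoint) T_symm
    (fun v => by rw [inner_T]; exact real_inner_self_nonneg) (norm_pos_iff.1 norm_pos)
  refine ⟨v, hv0, ‖T‖⁻¹, (inv_le_iff_one_le_mul₀ norm_pos).2 one_le, fun g => ?_⟩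
  rw [← inner_T, hv, real_inner_smul_left, inv_mul_cancel_left₀ norm_pos.ne']

theorem finrank_le_rank_formEigenvectors (hb : IsCompactOperator b) (hx : 0 < x)
    (W : Submodule ℝ H) [FiniteDimensional ℝ W] (hW : ∀ w ∈ W, ‖w‖ ^ 2 ≤ x * ‖b w‖ ^ 2) :
    (Module.finrank ℝ W : Cardinal) ≤
      Module.rank ℝ (Submodule.span ℝ (formEigenvectors b x)) := by
  set V := Submodule.span ℝ (formEigenvectors b x)
  by_contra! hlt
  have : FiniteDimensional ℝ V := Module.rank_lt_aleph0_iff.1 (hlt.trans Cardinal.natCast_lt_aleph0)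
  rw [← Module.finrank_eq_rank, Nat.cast_lt] at hlt
  obtain ⟨w, hwW, hwV, hw0⟩ := exists_ne_zero_mem_orthogonal_of_finrank_lt hlt
  -- An eigenvector of the restriction of the form to `Vᗮ` is one of the form itself.
  obtain ⟨v, hv0, l, hlx, hv⟩ := formEigenvectors_nonempty (b := b ∘L Vᗮ.subtypeL)
    (hb.comp_clm Vᗮ.subtypeL) hx (w := ⟨w, hwV⟩) (fun h => hw0 (congrArg Subtype.val h)) (hW w hwW)
  have hvV : (v : H) ∈ V := by
    refine Submodule.subset_span ⟨fun h => hv0 (Subtype.ext h), l, hlx, fun g => ?_⟩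
    obtain ⟨p, hp, q, hq, rfl⟩ := V.exists_add_mem_mem_orthogonal g
    rw [inner_add_right, Submodule.inner_left_of_mem_orthogonal hp v.2, zero_add, map_add,
      inner_add_right, real_inner_comm (b p), inner_map_map_eq_zero_of_mem_orthogonal hp v.2,
      zero_add]
    exact hv ⟨q, hq⟩
  exact hv0 (Subtype.ext (inner_self_eq_zero.1 (v.2 v hvV)))

end Variational

/-! ### Primitives of square integrable functions -/

/-- `L²([0,1])`, the space of weak derivatives. -/
abbrev L2I : Type := Lp ℝ 2 (volume.restrict (Icc (0 : ℝ) 1))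

/-- The indicator function of `(p, q]` as an element of `L²([0,1])`: the inner product with it is
the integral from `p` to `q`. -/
def step (p q : ℝ) : L2I :=
  indicatorConstLp 2 (measurableSet_Ioc : MeasurableSet (Ioc p q)) (measure_ne_top _ _) 1

theorem intervalIntegrable_of_memLp {g : ℝ → ℝ} (hg : MemLp g 2 (volume.restrict (Icc (0 : ℝ) 1)))
    {p q : ℝ} (hp : p ∈ Icc (0 : ℝ) 1) (hq : q ∈ Icc (0 : ℝ) 1) :
    IntervalIntegrable g volume p q := by
  have integrableOn : IntegrableOn g (Icc 0 1) := hg.integrable one_le_two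
  exact (integrableOn.mono_set (uIcc_subset_Icc hp hq)).intervalIntegrable

theorem L2I.intervalIntegrable (u : L2I) {p q : ℝ} (hp : p ∈ Icc (0 : ℝ) 1)
    (hq : q ∈ Icc (0 : ℝ) 1) : IntervalIntegrable u volume p q :=
  intervalIntegrable_of_memLp (Lp.memLp u) hp hq

theorem inner_step {p q : ℝ} (hp : 0 ≤ p) (hpq : p ≤ q) (hq : q ≤ 1) (u : L2I) :
    inner ℝ (step p q) u = ∫ t in p..q, u t := by
  rw [step, L2.inner_indicatorConstLp_one, Measure.restrict_restrict measurableSet_Ioc,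
    inter_eq_left.2 (Ioc_subset_Icc_self.trans (Icc_subset_Icc hp hq)),
    intervalIntegral.integral_of_le hpq]

theorem inner_step_step {p q : ℝ} (hp : 0 ≤ p) (hq : q ≤ 1) (r s : ℝ) :
    inner ℝ (step p q) (step r s) = max (min q s - max p r) 0 := by
  rw [step, step, L2.real_inner_indicatorConstLp_one_indicatorConstLp_one, Ioc_inter_Ioc,
    measureReal_restrict_apply measurableSet_Ioc, inter_eq_left.2, Real.volume_real_Ioc]
  exact Ioc_subset_Icc_self.trans
    (Icc_subset_Icc (hp.trans (le_max_left _ _)) ((min_le_left _ _).trans hq))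

theorem norm_step_sq {p q : ℝ} (hp : 0 ≤ p) (hpq : p ≤ q) (hq : q ≤ 1) :
    ‖step p q‖ ^ 2 = q - p := by
  rw [← real_inner_self_eq_norm_sq, inner_step_step hp hq, min_self, max_self,
    max_eq_left (sub_nonneg.2 hpq)]

theorem dist_step_zero (x y : I) : dist (step 0 x) (step 0 y) = √(dist x y) := by
  wlog hxy : x ≤ y generalizing x y
  · rw [dist_comm, dist_comm x, this y x (le_of_not_ge hxy)]
  have hxy' : (x : ℝ) ≤ y := hxy
  rw [dist_eq_norm, eq_comm, Real.sqrt_eq_iff_eq_sq dist_nonneg (norm_nonneg _),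
    norm_sub_sq_real, norm_step_sq le_rfl x.2.1 x.2.2, norm_step_sq le_rfl y.2.1 y.2.2,
    inner_step_step le_rfl x.2.2, min_eq_left hxy', max_self, sub_zero, max_eq_left x.2.1,
    Subtype.dist_eq, dist_comm, Real.dist_eq, abs_of_nonneg (sub_nonneg.2 hxy')]
  ring

theorem abs_inner_step_zero_le (u : L2I) (x : I) : |inner ℝ (step 0 x) u| ≤ ‖u‖ := by
  refine (abs_real_inner_le_norm _ _).trans (mul_le_of_le_one_left (norm_nonneg _) ?_)
  rw [← sq_le_one_iff₀ (norm_nonneg _), norm_step_sq le_rfl x.2.1 x.2.2, sub_zero]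
  exact x.2.2

theorem dist_inner_step_zero_le (u : L2I) (x y : I) :
    dist (inner ℝ (step 0 x) u) (inner ℝ (step 0 y) u) ≤ √(dist x y) * ‖u‖ := by
  rw [Real.dist_eq, ← inner_sub_left, ← dist_step_zero, dist_eq_norm]
  exact abs_real_inner_le_norm _ _

theorem continuous_step_zero : Continuous fun x : I => step 0 x := by
  refine continuous_iff_continuousAt.2 fun y => tendsto_iff_dist_tendsto_zero.2 ?_
  simp only [dist_step_zero]
  exact (Real.continuous_sqrt.comp (continuous_id.dist continuous_const)).tendsto' y 0 (by simp)

/-- The primitive `x ↦ ∫₀ˣ u`, as a continuous linear map. -/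
def primitive : L2I →L[ℝ] C(I, ℝ) :=
  LinearMap.mkContinuous
    { toFun u := ⟨fun x => inner ℝ (step 0 x) u, continuous_step_zero.inner continuous_const⟩
      map_add' u v := by ext x; exact inner_add_right (𝕜 := ℝ) (step 0 x) u v
      map_smul' c u := by ext x; exact real_inner_smul_right (step 0 x) u c } 1 fun u => by
    rw [one_mul]
    exact (ContinuousMap.norm_le _ (norm_nonneg u)).2 (abs_inner_step_zero_le u)

theorem primitive_eq_inner (u : L2I) (x : I) : primitive u x = inner ℝ (step 0 x) u := rfl

theorem primitive_apply (u : L2I) (x : I) : primitive u x = ∫ t in (0 : ℝ)..x, u t :=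
  inner_step le_rfl x.2.1 x.2.2 u

theorem primitive_sub (u : L2I) {x y : I} (hxy : x ≤ y) :
    primitive u y - primitive u x = inner ℝ (step x y) u := by
  rw [inner_step x.2.1 hxy y.2.2, primitive_apply, primitive_apply]
  exact intervalIntegral.integral_interval_sub_left
    (u.intervalIntegrable (by simp) y.2) (u.intervalIntegrable (by simp) x.2)

theorem primitive_zero (u : L2I) : primitive u 0 = 0 :=
  (primitive_apply u 0).trans intervalIntegral.integral_same

theorem ae_eq_zero_of_forall_integral_eq_zero {g : ℝ → ℝ}
    (hg : MemLp g 2 (volume.restrict (Icc (0 : ℝ) 1)))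
    (hg0 : ∀ x : I, ∫ t in (0 : ℝ)..x, g t = 0) : g =ᵐ[volume.restrict (Icc (0 : ℝ) 1)] 0 := by
  -- Lebesgue differentiation
  have hasDerivAt := (intervalIntegrable_of_memLp hg (p := 0) (q := 1) (by simp)
    (by simp)).ae_hasDerivAt_integral
  rw [restrict_Ioo_eq_restrict_Icc.symm, Filter.EventuallyEq, ae_restrict_iff' measurableSet_Ioo]
  filter_upwards [hasDerivAt] with x hx hx01
  have eventually_zero : (fun y => ∫ t in (0 : ℝ)..y, g t) =ᶠ[nhds x] fun _ => 0 := by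
    filter_upwards [Ioo_mem_nhds hx01.1 hx01.2] with y hy
    exact hg0 ⟨y, Ioo_subset_Icc_self hy⟩
  refine HasDerivAt.unique ?_ ((hasDerivAt_const x (0 : ℝ)).congr_of_eventuallyEq eventually_zero)
  exact hx (by rw [uIcc_of_le zero_le_one]; exact Ioo_subset_Icc_self hx01) 0 (by simp)

theorem primitive_injective : Function.Injective primitive := by
  refine (injective_iff_map_eq_zero _).2 fun u hu => (Lp.eq_zero_iff_ae_eq_zero).2 ?_
  refine ae_eq_zero_of_forall_integral_eq_zero (Lp.memLp u) fun x => ?_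
  rw [← primitive_apply, hu, ContinuousMap.zero_apply]

theorem HasWeakDeriv.ae_eq {f : C(I, ℝ)} {g h : ℝ → ℝ} (hg : HasWeakDeriv f g)
    (hh : HasWeakDeriv f h) : g =ᵐ[volume.restrict (Icc (0 : ℝ) 1)] h := by
  have sub_ae_eq := ae_eq_zero_of_forall_integral_eq_zero (hg.1.sub hh.1) fun x => by
    simp only [Pi.sub_apply]
    rw [intervalIntegral.integral_sub (intervalIntegrable_of_memLp hg.1 (by simp) x.2)
      (intervalIntegrable_of_memLp hh.1 (by simp) x.2), sub_eq_zero]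
    exact add_left_cancel ((hg.2 x).symm.trans (hh.2 x))
  filter_upwards [sub_ae_eq] with t ht using sub_eq_zero.1 ht

theorem hasWeakDeriv_primitive (u : L2I) : HasWeakDeriv (primitive u) u :=
  ⟨Lp.memLp u, fun x => by rw [primitive_zero, zero_add, primitive_apply]⟩

theorem weakDeriv_primitive_ae_eq (u : L2I) :
    weakDeriv (primitive u) =ᵐ[volume.restrict (Icc (0 : ℝ) 1)] u :=
  (Classical.epsilon_spec (p := HasWeakDeriv (primitive u))
    ⟨_, hasWeakDeriv_primitive u⟩).ae_eq (hasWeakDeriv_primitive u)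

theorem energy_primitive (u v : L2I) : energy (primitive u) (primitive v) = inner ℝ u v := by
  rw [energy, L2.inner_def]
  refine integral_congr_ae ?_
  filter_upwards [weakDeriv_primitive_ae_eq u, weakDeriv_primitive_ae_eq v] with t hu hv
  rw [hu, hv]
  exact mul_comm _ _

theorem memH10_iff {f : C(I, ℝ)} : MemH10 f ↔ ∃ u, primitive u 1 = 0 ∧ primitive u = f := by
  constructor
  · rintro ⟨⟨g, hg, hgf⟩, hf0, hf1⟩
    have primitive_eq : primitive (hg.toLp g) = f := by
      ext x
      rw [primitive_apply, hgf x, hf0, zero_add]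
      refine intervalIntegral.integral_congr_ae_restrict
        (ae_restrict_of_ae_restrict_of_subset ?_ hg.coeFn_toLp)
      rw [uIoc_of_le x.2.1]
      exact Ioc_subset_Icc_self.trans (Icc_subset_Icc_right x.2.2)
    exact ⟨hg.toLp g, by rw [primitive_eq, hf1], primitive_eq⟩
  · rintro ⟨u, hu, rfl⟩
    exact ⟨⟨u, hasWeakDeriv_primitive u⟩, primitive_zero u, hu⟩

theorem isCompactOperator_primitive : IsCompactOperator primitive := by
  -- Arzelà–Ascoli is available for bounded continuous functions.
  let e := ContinuousMap.linearIsometryBoundedOfCompact I ℝ ℝ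
  let G : L2I →L[ℝ] BoundedContinuousFunction I ℝ :=
    (e.toContinuousLinearEquiv : C(I, ℝ) →L[ℝ] BoundedContinuousFunction I ℝ) ∘L primitive
  have isCompact_closure : IsCompact (closure (G '' Metric.closedBall 0 1)) := by
    refine BoundedContinuousFunction.arzela_ascoli (Icc (-1) 1) isCompact_Icc _ ?_ ?_
    · rintro f x ⟨u, hu, rfl⟩
      exact abs_le.1 ((abs_inner_step_zero_le u x).trans (mem_closedBall_zero_iff.1 hu))
    · refine Metric.equicontinuous_of_continuity_modulus (fun t => √t) ?_ _ ?_
      · simpa using Real.continuous_sqrt.tendsto 0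
      · rintro x y ⟨f, u, hu, rfl⟩
        exact (dist_inner_step_zero_le u x y).trans
          (mul_le_of_le_one_right (Real.sqrt_nonneg _) (mem_closedBall_zero_iff.1 hu))
  have isCompactOperator : IsCompactOperator G :=
    (isCompactOperator_iff_isCompact_closure_image_closedBall (𝕜₁ := ℝ)
      (G : L2I →ₗ[ℝ] BoundedContinuousFunction I ℝ) one_pos).2 isCompact_closure
  exact isCompactOperator.clm_comp
    (e.symm.toContinuousLinearEquiv : BoundedContinuousFunction I ℝ →L[ℝ] C(I, ℝ))

/-! ### The Dirichlet form as a form on `L²([0,1])` -/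

instance (ν : Measure ℝ) [IsFiniteMeasure ν] :
    IsFiniteMeasure (ν.comap (Subtype.val : I → ℝ)) :=
  ⟨(comap_subtype_coe_apply measurableSet_Icc ν univ).trans_lt (measure_lt_top _ _)⟩

/-- The domain of the Dirichlet form, identified with the space of weak derivatives of its
elements: the form is then the inner product of `L²([0,1])`. -/
def formDomain (ν : Measure ℝ) : Submodule ℝ L2I where
  carrier := {u | primitive u 1 = 0 ∧ AffineOffSupport ν (primitive u)}
  zero_mem' := ⟨by simp, fun x _ => ⟨0, 0, fun y _ => by simp⟩⟩
  add_mem' {u v} hu hv := by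
    refine ⟨by rw [map_add, ContinuousMap.add_apply, hu.1, hv.1, add_zero], fun x hx => ?_⟩
    obtain ⟨a, b, hab⟩ := hu.2 x hx
    obtain ⟨a', b', hab'⟩ := hv.2 x hx
    refine ⟨a + a', b + b', fun y hy => ?_⟩
    rw [map_add, ContinuousMap.add_apply, hab y hy, hab' y hy]; ring
  smul_mem' c u hu := by
    refine ⟨by rw [map_smul, ContinuousMap.smul_apply, hu.1, smul_zero], fun x hx => ?_⟩
    obtain ⟨a, b, hab⟩ := hu.2 x hx
    refine ⟨c * a, c * b, fun y hy => ?_⟩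
    rw [map_smul, ContinuousMap.smul_apply, hab y hy, smul_eq_mul]; ring

theorem memDom_iff {ν : Measure ℝ} {f : C(I, ℝ)} :
    MemDom ν f ↔ ∃ u ∈ formDomain ν, primitive u = f := by
  rw [MemDom, memH10_iff]
  constructor
  · rintro ⟨⟨u, hu, rfl⟩, haffine⟩
    exact ⟨u, ⟨hu, haffine⟩, rfl⟩
  · rintro ⟨u, hu, rfl⟩
    exact ⟨⟨u, hu.1, rfl⟩, hu.2⟩

section FiniteMeasure

variable (ν : Measure ℝ) [IsFiniteMeasure ν]

/-- The map taking `u` to its primitive, viewed in `L²(ν)`. -/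
def embed : L2I →L[ℝ] Lp ℝ 2 (ν.comap (Subtype.val : I → ℝ)) :=
  ContinuousMap.toLp 2 (ν.comap (Subtype.val : I → ℝ)) ℝ ∘L primitive

/-- The embedding of the domain of the form into `L²(ν)`. -/
def embedDom : formDomain ν →L[ℝ] Lp ℝ 2 (ν.comap (Subtype.val : I → ℝ)) :=
  embed ν ∘L (formDomain ν).subtypeL

theorem inner_embed (u v : L2I) :
    inner ℝ (embed ν u) (embed ν v) = innerL2 ν (primitive u) (primitive v) := by
  rw [embed, ContinuousLinearMap.comp_apply, ContinuousLinearMap.comp_apply,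
    ContinuousMap.inner_toLp, innerL2]
  exact integral_congr_ae (Eventually.of_forall fun x => mul_comm _ _)

theorem isEigenfunction_primitive_iff {l : ℝ} {u : formDomain ν} :
    IsEigenfunction ν l (primitive u) ↔ u ≠ 0 ∧ u ∈ formEigenspace (embedDom ν) l := by
  have primitive_ne_zero : primitive (u : L2I) ≠ 0 ↔ u ≠ 0 := by
    rw [Ne, map_eq_zero_iff _ primitive_injective, ZeroMemClass.coe_eq_zero]
  refine ⟨fun ⟨_, hne, heq⟩ => ⟨primitive_ne_zero.1 hne, fun v => ?_⟩,
    fun ⟨hne, heq⟩ => ⟨memDom_iff.2 ⟨u, u.2, rfl⟩, primitive_ne_zero.2 hne, fun g hg => ?_⟩⟩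
  · have h := heq (primitive v) (memDom_iff.2 ⟨v, v.2, rfl⟩)
    rwa [energy_primitive, ← inner_embed] at h
  · obtain ⟨v, hv, rfl⟩ := memDom_iff.1 hg
    rw [energy_primitive, ← inner_embed]
    exact heq ⟨v, hv⟩

theorem eigenvalueCount_eq (x : ℝ) :
    eigenvalueCount ν x = Cardinal.toENat
      (Module.rank ℝ (Submodule.span ℝ (formEigenvectors (embedDom ν) x))) := by
  let Φ : formDomain ν →ₗ[ℝ] C(I, ℝ) := (primitive : L2I →ₗ[ℝ] C(I, ℝ)) ∘ₗ (formDomain ν).subtype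
  have hΦ : Function.Injective Φ := primitive_injective.comp Subtype.val_injective
  have setOf_eq : {f : C(I, ℝ) | ∃ l : ℝ, l ≤ x ∧ IsEigenfunction ν l f} =
      Φ '' formEigenvectors (embedDom ν) x := by
    ext f
    constructor
    · rintro ⟨l, hl, hf⟩
      obtain ⟨u, hu, rfl⟩ := memDom_iff.1 hf.1
      obtain ⟨hne, hmem⟩ := (isEigenfunction_primitive_iff ν (u := ⟨u, hu⟩)).1 hf
      exact ⟨⟨u, hu⟩, ⟨hne, l, hl, hmem⟩, rfl⟩
    · rintro ⟨u, ⟨hne, l, hl, hmem⟩, rfl⟩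
      exact ⟨l, hl, (isEigenfunction_primitive_iff ν).2 ⟨hne, hmem⟩⟩
  rw [eigenvalueCount, setOf_eq, Submodule.span_image,
    ← (Submodule.equivMapOfInjective Φ hΦ _).rank_eq]

end FiniteMeasure

/-! ### Dirichlet–Neumann bracketing: the upper bound for the counting function -/

theorem sum_intervalIntegral_partition {n : ℕ} (c : Fin (n + 1) → ℝ) {f : ℝ → ℝ} {μ : Measure ℝ}
    (hf : ∀ i j, IntervalIntegrable f μ (c i) (c j)) :
    ∑ k : Fin n, ∫ t in c k.castSucc..c k.succ, f t ∂μ = ∫ t in c 0..c (Fin.last n), f t ∂μ := by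
  induction n with
  | zero => simp
  | succ n ih =>
    rw [Fin.sum_univ_castSucc]
    simp only [Fin.succ_castSucc, Fin.succ_last]
    rw [ih (fun i => c i.castSucc) fun i j => hf _ _]
    exact intervalIntegral.integral_add_adjacent_intervals (hf _ _) (hf _ _)

theorem sq_intervalIntegral_le {g : ℝ → ℝ} {a b : ℝ} (hab : a ≤ b)
    (hg : IntervalIntegrable g volume a b)
    (hg2 : IntervalIntegrable (fun t => g t ^ 2) volume a b) :
    (∫ t in a..b, g t) ^ 2 ≤ (b - a) * ∫ t in a..b, g t ^ 2 := by
  obtain rfl | hlt := hab.eq_or_lt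
  · simp
  set A := ∫ t in a..b, g t
  have expand : ∫ t in a..b, ((b - a) * g t - A) ^ 2 =
      (b - a) * ((b - a) * (∫ t in a..b, g t ^ 2) - A ^ 2) := by
    have integrand_eq : ∀ t, ((b - a) * g t - A) ^ 2 =
        (b - a) ^ 2 * g t ^ 2 - 2 * (b - a) * A * g t + A ^ 2 := fun t => by ring
    simp only [integrand_eq]
    rw [intervalIntegral.integral_add ((hg2.const_mul _).sub (hg.const_mul _))
      intervalIntegrable_const, intervalIntegral.integral_sub (hg2.const_mul _) (hg.const_mul _),
      intervalIntegral.integral_const_mul, intervalIntegral.integral_const_mul,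
      intervalIntegral.integral_const, smul_eq_mul]
    ring
  have nonneg : 0 ≤ ∫ t in a..b, ((b - a) * g t - A) ^ 2 :=
    intervalIntegral.integral_nonneg hab fun t _ => sq_nonneg _
  rw [expand] at nonneg
  exact sub_nonneg.1 (nonneg_of_mul_nonneg_right nonneg (sub_pos.2 hlt))

theorem L2I.intervalIntegrable_sq (u : L2I) {p q : ℝ} (hp : p ∈ Icc (0 : ℝ) 1)
    (hq : q ∈ Icc (0 : ℝ) 1) : IntervalIntegrable (fun t => u t ^ 2) volume p q := by
  have integrableOn : IntegrableOn (fun t => u t ^ 2) (Icc 0 1) := (Lp.memLp u).integrable_sq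
  exact (integrableOn.mono_set (uIcc_subset_Icc hp hq)).intervalIntegrable

theorem L2I.norm_sq (u : L2I) : ‖u‖ ^ 2 = ∫ t in (0 : ℝ)..1, u t ^ 2 := by
  rw [← real_inner_self_eq_norm_sq, L2.inner_def, intervalIntegral.integral_of_le zero_le_one,
    integral_Icc_eq_integral_Ioc]
  exact integral_congr_ae (Eventually.of_forall fun t => (sq (u t)).symm)

section Bracketing

variable {ν : Measure ℝ} {n : ℕ} {c : Fin (n + 1) → ℝ} {x : ℝ}

theorem IsPartition.mem_Icc (hc : IsPartition ν c) (i : Fin (n + 1)) : c i ∈ Icc (0 : ℝ) 1 :=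
  ⟨hc.2.1 ▸ hc.1.monotone (Fin.zero_le i), hc.2.2.1 ▸ hc.1.monotone (Fin.le_last i)⟩

theorem norm_sq_eq_sum (hc : IsPartition ν c) (u : L2I) :
    ‖u‖ ^ 2 = ∑ k : Fin n, ∫ t in c k.castSucc..c k.succ, u t ^ 2 := by
  rw [sum_intervalIntegral_partition c fun i j =>
    u.intervalIntegrable_sq (hc.mem_Icc i) (hc.mem_Icc j), hc.2.1, hc.2.2.1, L2I.norm_sq]

variable [IsFiniteMeasure ν]

theorem integrableOn_primitive_sq (u : L2I) :
    IntegrableOn (fun y : ℝ => (∫ t in (0 : ℝ)..y, u t) ^ 2) (Icc 0 1) ν := by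
  have continuousOn : ContinuousOn (fun y : ℝ => ∫ t in (0 : ℝ)..y, u t) (uIcc 0 1) :=
    intervalIntegral.continuousOn_primitive_interval' (u.intervalIntegrable (by simp) (by simp))
      left_mem_uIcc
  rw [uIcc_of_le zero_le_one] at continuousOn
  exact (continuousOn.pow 2).integrableOn_compact isCompact_Icc

theorem norm_embed_sq (u : L2I) :
    ‖embed ν u‖ ^ 2 = ∫ y in Icc (0 : ℝ) 1, (∫ t in (0 : ℝ)..y, u t) ^ 2 ∂ν := by
  rw [← real_inner_self_eq_norm_sq, inner_embed, innerL2,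
    ← integral_subtype_comap measurableSet_Icc]
  refine integral_congr_ae (Eventually.of_forall fun x => ?_)
  simp only [primitive_apply, sq]

theorem sq_integral_le_of_integral_eq_zero {u : L2I} {a b y : ℝ} (ha : 0 ≤ a) (hb : b ≤ 1)
    (hua : ∫ t in (0 : ℝ)..a, u t = 0) (hy : y ∈ Ioc a b) :
    (∫ t in (0 : ℝ)..y, u t) ^ 2 ≤ (b - a) * ∫ t in a..b, u t ^ 2 := by
  have haI : a ∈ Icc (0 : ℝ) 1 := ⟨ha, hy.1.le.trans (hy.2.trans hb)⟩
  have hyI : y ∈ Icc (0 : ℝ) 1 := ⟨ha.trans hy.1.le, hy.2.trans hb⟩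
  have hbI : b ∈ Icc (0 : ℝ) 1 := ⟨hyI.1.trans hy.2, hb⟩
  rw [← intervalIntegral.integral_add_adjacent_intervals (u.intervalIntegrable (by simp) haI)
    (u.intervalIntegrable haI hyI), hua, zero_add]
  refine (sq_intervalIntegral_le hy.1.le (u.intervalIntegrable haI hyI)
    (u.intervalIntegrable_sq haI hyI)).trans ?_
  refine mul_le_mul (sub_le_sub_right hy.2 a) ?_
    (intervalIntegral.integral_nonneg hy.1.le fun t _ => sq_nonneg _)
    (sub_nonneg.2 (hy.1.le.trans hy.2))
  exact intervalIntegral.integral_mono_interval le_rfl hy.1.le hy.2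
    (Eventually.of_forall fun t => sq_nonneg (u t)) (u.intervalIntegrable_sq haI hbI)

theorem integral_primitive_sq_le {u : L2I} {a b : ℝ} (ha : 0 ≤ a) (hab : a ≤ b) (hb : b ≤ 1)
    (hua : ∫ t in (0 : ℝ)..a, u t = 0) :
    ∫ y in a..b, (∫ t in (0 : ℝ)..y, u t) ^ 2 ∂ν ≤
      ν.real (Ioc a b) * (b - a) * ∫ t in a..b, u t ^ 2 := by
  rw [intervalIntegral.integral_of_le hab]
  refine (setIntegral_mono_on ((integrableOn_primitive_sq u).mono_set
    (Ioc_subset_Icc_self.trans (Icc_subset_Icc ha hb))) (integrable_const _) measurableSet_Ioc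
    fun y hy => sq_integral_le_of_integral_eq_zero ha hb hua hy).trans (le_of_eq ?_)
  rw [setIntegral_const, smul_eq_mul, mul_assoc]

theorem norm_embed_sq_eq_sum (hc : IsPartition ν c) (u : L2I) : ‖embed ν u‖ ^ 2 =
    ∑ k : Fin n, ∫ y in c k.castSucc..c k.succ, (∫ t in (0 : ℝ)..y, u t) ^ 2 ∂ν := by
  have no_atom : ν {(0 : ℝ)} = 0 := hc.2.1 ▸ hc.2.2.2 0
  rw [sum_intervalIntegral_partition c fun i j => ((integrableOn_primitive_sq u).mono_set
    (uIcc_subset_Icc (hc.mem_Icc i) (hc.mem_Icc j))).intervalIntegrable, hc.2.1, hc.2.2.1,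
    norm_embed_sq, intervalIntegral.integral_of_le zero_le_one]
  exact integral_Icc_eq_integral_Ioc' no_atom

theorem norm_embed_sq_lt (hc : IsPartition ν c)
    (hcx : ∀ k : Fin n, ν.real (Ioc (c k.castSucc) (c k.succ)) *
      volume.real (Ioc (c k.castSucc) (c k.succ)) < 1 / x) {u : L2I} (hu : u ≠ 0)
    (hu0 : ∀ k : Fin n, ∫ t in (0 : ℝ)..c k.castSucc, u t = 0) :
    ‖embed ν u‖ ^ 2 < 1 / x * ‖u‖ ^ 2 := by
  have cell_lt : ∀ k : Fin n, c k.castSucc < c k.succ := fun k => hc.1 Fin.castSucc_lt_succ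
  have mass_mul_length_lt : ∀ k : Fin n, ν.real (Ioc (c k.castSucc) (c k.succ)) *
      (c k.succ - c k.castSucc) < 1 / x := fun k => by
    have h := hcx k
    rwa [Real.volume_real_Ioc_of_le (cell_lt k).le] at h
  have energy_nonneg : ∀ k : Fin n, 0 ≤ ∫ t in c k.castSucc..c k.succ, u t ^ 2 := fun k =>
    intervalIntegral.integral_nonneg (cell_lt k).le fun t _ => sq_nonneg _
  obtain ⟨k₀, -, energy_pos⟩ : ∃ k ∈ (Finset.univ : Finset (Fin n)),
      0 < ∫ t in c k.castSucc..c k.succ, u t ^ 2 := by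
    refine Finset.exists_lt_of_sum_lt (f := fun _ => (0 : ℝ)) ?_
    rw [Finset.sum_const_zero, ← norm_sq_eq_sum hc]
    exact pow_pos (norm_pos_iff.2 hu) 2
  rw [norm_embed_sq_eq_sum hc, norm_sq_eq_sum hc, Finset.mul_sum]
  refine (Finset.sum_le_sum fun k _ => integral_primitive_sq_le (hc.mem_Icc _).1 (cell_lt k).le
    (hc.mem_Icc _).2 (hu0 k)).trans_lt ?_
  exact Finset.sum_lt_sum
    (fun k _ => mul_le_mul_of_nonneg_right (mass_mul_length_lt k).le (energy_nonneg k))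
    ⟨k₀, Finset.mem_univ _, mul_lt_mul_of_pos_right (mass_mul_length_lt k₀) energy_pos⟩

theorem eigenvalueCount_le_partitionCount (hx : 0 < x) :
    eigenvalueCount ν x ≤ partitionCount ν x := by
  refine le_sInf ?_
  rintro _ ⟨n, c, rfl, hc, hcx⟩
  rw [eigenvalueCount_eq]
  set V := Submodule.span ℝ (formEigenvectors (embedDom ν) x)
  let eval : V →ₗ[ℝ] (Fin n → ℝ) := LinearMap.pi fun k =>
    (ContinuousMap.evalCLM ℝ (⟨c k.castSucc, hc.mem_Icc _⟩ : I) ∘L primitive ∘L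
      (formDomain ν).subtypeL : formDomain ν →ₗ[ℝ] ℝ) ∘ₗ V.subtype
  have eval_injective : Function.Injective eval := by
    refine (injective_iff_map_eq_zero _).2 fun v hv => ?_
    by_contra hv0
    have rayleigh_lt := norm_embed_sq_lt hc hcx (u := v)
      (fun h => hv0 (Subtype.ext (Subtype.ext h)))
      fun k => (primitive_apply _ _).symm.trans (congrFun hv k)
    rw [one_div, inv_mul_eq_div, lt_div_iff₀' hx] at rayleigh_lt
    exact rayleigh_lt.not_ge (norm_sq_le_of_mem_span_formEigenvectors (b := embedDom ν) v.2)
  have rank_le := LinearMap.rank_le_of_injective eval eval_injective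
  rw [rank_fin_fun] at rank_le
  exact Cardinal.toENat_le_natCast.2 rank_le

end Bracketing

/-! ### Reduction from `H¹₀` to the domain of the form -/

theorem exists_affine_iff {C : Set I} {f : I → ℝ} :
    (∃ a b : ℝ, ∀ y ∈ C, f y = a * y + b) ↔ ∀ p ∈ C, ∀ q ∈ C, ∀ r ∈ C, p ≤ q → q ≤ r →
      f p * ((q : ℝ) - r) + f q * ((r : ℝ) - p) + f r * ((p : ℝ) - q) = 0 := by
  constructor
  · rintro ⟨a, b, h⟩ p hp q hq r hr - -
    rw [h p hp, h q hq, h r hr]; ring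
  · intro collinear
    rcases C.subsingleton_or_nontrivial with hC | hC
    · rcases C.eq_empty_or_nonempty with rfl | ⟨p, hp⟩
      · exact ⟨0, 0, fun y hy => (notMem_empty y hy).elim⟩
      · exact ⟨0, f p, fun y hy => by rw [hC hy hp]; ring⟩
    · obtain ⟨p, hp, q, hq, hpq⟩ := hC.exists_lt
      have coe_sub_ne_zero : (q : ℝ) - p ≠ 0 := (sub_pos.2 (Subtype.coe_lt_coe.2 hpq)).ne'
      refine ⟨(f q - f p) / (q - p), f p - (f q - f p) / (q - p) * p, fun y hy => ?_⟩
      suffices f y * (q - p) = (f q - f p) * y + (f p * (q - p) - (f q - f p) * p) by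
        field_simp
        linarith
      rcases le_total y p with hyp | hpy
      · linarith [collinear y hy p hp q hq hyp hpq.le]
      · rcases le_total y q with hyq | hqy
        · linarith [collinear p hp y hy q hq hpy hyq]
        · linarith [collinear p hp q hq y hy hpq.le hqy]

theorem continuous_primitive_apply (x : I) : Continuous fun u : L2I => primitive u x :=
  (ContinuousEvalConst.continuous_eval_const x).comp primitive.continuous

theorem isClosed_formDomain (ν : Measure ℝ) : IsClosed (formDomain ν : Set L2I) := by
  have isClosed_collinear (p q r : I) : IsClosed {u : L2I | primitive u p * ((q : ℝ) - r) +
      primitive u q * ((r : ℝ) - p) + primitive u r * ((p : ℝ) - q) = 0} :=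
    isClosed_eq ((((continuous_primitive_apply p).mul continuous_const).add
      ((continuous_primitive_apply q).mul continuous_const)).add
      ((continuous_primitive_apply r).mul continuous_const)) continuous_const
  have coe_eq : (formDomain ν : Set L2I) = {u | primitive u 1 = 0} ∩
      {u | AffineOffSupport ν (primitive u)} := rfl
  rw [coe_eq]
  simp only [AffineOffSupport, exists_affine_iff, ofPred_forall]
  refine (isClosed_eq (continuous_primitive_apply 1) continuous_const).inter ?_
  exact isClosed_iInter fun x => isClosed_iInter fun _ => isClosed_iInter fun p =>
    isClosed_iInter fun _ => isClosed_iInter fun q => isClosed_iInter fun _ =>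
    isClosed_iInter fun r => isClosed_iInter fun _ => isClosed_iInter fun _ =>
    isClosed_iInter fun _ => isClosed_collinear p q r

instance (ν : Measure ℝ) : CompleteSpace (formDomain ν) :=
  (isClosed_formDomain ν).completeSpace_coe

/-- The weak derivatives of the functions in `H¹₀` that vanish on the support of `ν`; among the
weak derivatives of elements of `H¹₀`, those in its orthogonal complement belong to functions that
are affine off the support. -/
def vanishing (ν : Measure ℝ) : Submodule ℝ L2I :=
  (Submodule.span ℝ ((fun s : I => step 0 s) '' {s | s = 1 ∨ (s : ℝ) ∈ ν.support}))ᗮ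

theorem mem_vanishing_iff {ν : Measure ℝ} {u : L2I} :
    u ∈ vanishing ν ↔ primitive u 1 = 0 ∧ ∀ s : I, (s : ℝ) ∈ ν.support → primitive u s = 0 := by
  have mem_iff : u ∈ vanishing ν ↔ ∀ s : I, s = 1 ∨ (s : ℝ) ∈ ν.support → primitive u s = 0 := by
    rw [vanishing, ← Submodule.span_singleton_le_iff_mem, ← Submodule.isOrtho_iff_le,
      Submodule.isOrtho_comm, Submodule.isOrtho_span]
    simp only [forall_mem_image, mem_singleton_iff, forall_eq, primitive_eq_inner, mem_ofPred_eq]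
  rw [mem_iff]
  exact ⟨fun h => ⟨h 1 (Or.inl rfl), fun s hs => h s (Or.inr hs)⟩,
    fun h s hs => hs.elim (fun e => e ▸ h.1) (h.2 s)⟩

section Step

variable {p q : ℝ} {y : I}

theorem primitive_step (p q : ℝ) (y : I) :
    primitive (step p q) y = max (min (y : ℝ) q - max 0 p) 0 := by
  rw [primitive_eq_inner, inner_step_step le_rfl y.2.2]

theorem primitive_step_of_le (hy : (y : ℝ) ≤ p) : primitive (step p q) y = 0 := by
  rw [primitive_step]
  exact max_eq_right
    (sub_nonpos.2 ((min_le_left _ _).trans (hy.trans (le_max_right _ _))))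

theorem primitive_step_of_ge (hp : 0 ≤ p) (hpq : p ≤ q) (hy : q ≤ y) :
    primitive (step p q) y = q - p := by
  rw [primitive_step, min_eq_right hy, max_eq_right hp, max_eq_left (sub_nonneg.2 hpq)]

end Step

theorem tent_mem_vanishing {ν : Measure ℝ} {p q r : I} (hpq : p ≤ q) (hqr : q ≤ r)
    (hsupp : ∀ s ∈ Icc p r, (s : ℝ) ∉ ν.support) :
    ((r : ℝ) - q) • step p q - ((q : ℝ) - p) • step q r ∈ vanishing ν := by
  have primitive_of_ge (y : I) (hy : r ≤ y) :
      primitive (((r : ℝ) - q) • step p q - ((q : ℝ) - p) • step q r) y = 0 := by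
    rw [map_sub, map_smul, map_smul, ContinuousMap.sub_apply, ContinuousMap.smul_apply,
      ContinuousMap.smul_apply, primitive_step_of_ge p.2.1 hpq (hqr.trans hy),
      primitive_step_of_ge q.2.1 hqr hy, smul_eq_mul, smul_eq_mul]
    ring
  have primitive_of_le (y : I) (hy : y ≤ p) :
      primitive (((r : ℝ) - q) • step p q - ((q : ℝ) - p) • step q r) y = 0 := by
    rw [map_sub, map_smul, map_smul, ContinuousMap.sub_apply, ContinuousMap.smul_apply,
      ContinuousMap.smul_apply, primitive_step_of_le hy, primitive_step_of_le (hy.trans hpq),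
      smul_zero, smul_zero, sub_zero]
  refine mem_vanishing_iff.2 ⟨primitive_of_ge 1 r.2.2, fun s hs => ?_⟩
  rcases le_total r s with hrs | hsr
  · exact primitive_of_ge s hrs
  · exact primitive_of_le s (le_of_not_ge fun hps => hsupp s ⟨hps, hsr⟩ hs)

theorem collinear_of_mem_orthogonal {ν : Measure ℝ} {u : L2I} (hu : u ∈ (vanishing ν)ᗮ)
    {p q r : I} (hpq : p ≤ q) (hqr : q ≤ r) (hsupp : ∀ s ∈ Icc p r, (s : ℝ) ∉ ν.support) :
    primitive u p * ((q : ℝ) - r) + primitive u q * ((r : ℝ) - p) +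
      primitive u r * ((p : ℝ) - q) = 0 := by
  have inner_tent := Submodule.inner_right_of_mem_orthogonal (tent_mem_vanishing hpq hqr hsupp) hu
  rw [inner_sub_left, real_inner_smul_left, real_inner_smul_left, ← primitive_sub u hpq,
    ← primitive_sub u hqr] at inner_tent
  linarith

theorem mem_formDomain_of_mem_orthogonal {ν : Measure ℝ} {u : L2I} (hu1 : primitive u 1 = 0)
    (hu : u ∈ (vanishing ν)ᗮ) : u ∈ formDomain ν := by
  refine ⟨hu1, fun x _ => exists_affine_iff.2 fun p hp q _ r hr hpq hqr =>
    collinear_of_mem_orthogonal hu hpq hqr fun s hs => ?_⟩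
  have ordConnected := (isPreconnected_connectedComponentIn
    (F := {z : I | (z : ℝ) ∉ ν.support}) (x := x)).ordConnected
  exact connectedComponentIn_subset {z : I | (z : ℝ) ∉ ν.support} x (ordConnected.out hp hr hs)

theorem sub_starProjection_mem_vanishing (ν : Measure ℝ) (u : L2I) :
    u - (vanishing ν)ᗮ.starProjection u ∈ vanishing ν := by
  have h := Submodule.sub_starProjection_mem_orthogonal (K := (vanishing ν)ᗮ) u
  rwa [vanishing, Submodule.triorthogonal_eq_orthogonal] at h

theorem starProjection_mem_formDomain (ν : Measure ℝ) {u : L2I} (hu1 : primitive u 1 = 0) :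
    (vanishing ν)ᗮ.starProjection u ∈ formDomain ν := by
  refine mem_formDomain_of_mem_orthogonal ?_ (Submodule.starProjection_apply_mem _ _)
  have h := (mem_vanishing_iff.1 (sub_starProjection_mem_vanishing ν u)).1
  rwa [map_sub, ContinuousMap.sub_apply, hu1, zero_sub, neg_eq_zero] at h

section FiniteMeasure

variable {ν : Measure ℝ} [IsFiniteMeasure ν] {x : ℝ}

theorem embed_eq_zero_of_mem_vanishing {u : L2I} (hu : u ∈ vanishing ν) : embed ν u = 0 := by
  rw [← norm_eq_zero, ← sq_eq_zero_iff, norm_embed_sq]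
  have mem_support : ∀ᵐ y ∂ν, y ∈ ν.support := Measure.support_mem_ae
  refine integral_eq_zero_of_ae ?_
  filter_upwards [ae_restrict_mem measurableSet_Icc, ae_restrict_of_ae mem_support] with y hyI hy
  rw [Pi.zero_apply, sq_eq_zero_iff]
  exact (primitive_apply u ⟨y, hyI⟩).symm.trans ((mem_vanishing_iff.1 hu).2 ⟨y, hyI⟩ hy)

theorem embed_starProjection (u : L2I) :
    embed ν ((vanishing ν)ᗮ.starProjection u) = embed ν u := by
  rw [eq_comm, ← sub_eq_zero, ← map_sub]
  exact embed_eq_zero_of_mem_vanishing (sub_starProjection_mem_vanishing ν u)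

theorem isCompactOperator_embedDom : IsCompactOperator (embedDom ν) :=
  (isCompactOperator_primitive.clm_comp
    (ContinuousMap.toLp 2 (ν.comap (Subtype.val : I → ℝ)) ℝ)).comp_clm (formDomain ν).subtypeL

-- The projection onto `(vanishing ν)ᗮ` decreases the energy and does not change the values on
-- the support of `ν`, so test functions need not be affine off the support.
theorem finrank_le_eigenvalueCount (hx : 0 < x) (U : Submodule ℝ L2I) [FiniteDimensional ℝ U]
    (hU1 : ∀ u ∈ U, primitive u 1 = 0) (hU : ∀ u ∈ U, ‖u‖ ^ 2 ≤ x * ‖embed ν u‖ ^ 2) :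
    (Module.finrank ℝ U : ℕ∞) ≤ eigenvalueCount ν x := by
  let Q : U →ₗ[ℝ] formDomain ν := LinearMap.codRestrict (formDomain ν)
    (((vanishing ν)ᗮ.starProjection : L2I →ₗ[ℝ] L2I) ∘ₗ U.subtype)
    fun u => starProjection_mem_formDomain ν (hU1 u u.2)
  have embedDom_Q (u : U) : embedDom ν (Q u) = embed ν u := embed_starProjection (u : L2I)
  have norm_Q_le (u : U) : ‖Q u‖ ≤ ‖(u : L2I)‖ :=
    (vanishing ν)ᗮ.norm_starProjection_apply_le u
  have Q_injective : Function.Injective Q := by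
    refine (injective_iff_map_eq_zero _).2 fun u hu => Subtype.ext (norm_eq_zero.1 ?_)
    have h := hU u u.2
    rw [← embedDom_Q, hu, map_zero, norm_zero, zero_pow two_ne_zero, mul_zero] at h
    exact sq_eq_zero_iff.1 (h.antisymm (sq_nonneg _))
  rw [eigenvalueCount_eq, ← LinearMap.finrank_range_of_inj Q_injective]
  refine Cardinal.natCast_le_toENat.2
    (finrank_le_rank_formEigenvectors isCompactOperator_embedDom hx (LinearMap.range Q) ?_)
  rintro _ ⟨u, rfl⟩
  rw [embedDom_Q]
  exact (pow_le_pow_left₀ (norm_nonneg _) (norm_Q_le u) 2).trans (hU u u.2)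

end FiniteMeasure

/-! ### Trapezoidal test functions -/

/-- Half the difference of the lengths of `(a, b]` and of the concentric interval `⟨(a, b]⟩ₘ`. -/
def flank (m a b : ℝ) : ℝ := (b - a) * (m - 1) / (2 * m)

/-- The weak derivative of the trapezoidal test function of `(a, b]`, which vanishes off `[a, b]`,
is `1` on `⟨(a, b]⟩ₘ`, and is affine in between. -/
def trapezoid (m a b : ℝ) : L2I :=
  (flank m a b)⁻¹ • (step a (a + flank m a b) - step (b - flank m a b) b)

section Trapezoid

variable {m a b : ℝ}

theorem flank_pos (hm : 1 < m) (hab : a < b) : 0 < flank m a b :=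
  div_pos (mul_pos (sub_pos.2 hab) (sub_pos.2 hm)) (by linarith)

theorem centered_eq_Icc_flank (hm : m ≠ 0) (a b : ℝ) :
    centered m a b = Icc (a + flank m a b) (b - flank m a b) := by
  rw [centered, flank]
  congr 1 <;> field_simp <;> ring

theorem sub_flank_sub_add_flank (hm : m ≠ 0) (a b : ℝ) :
    b - flank m a b - (a + flank m a b) = (b - a) / m := by
  rw [flank]
  field_simp
  ring

theorem add_flank_lt_sub_flank (hm : 0 < m) (hab : a < b) :
    a + flank m a b < b - flank m a b := by
  rw [← sub_pos, sub_flank_sub_add_flank hm.ne']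
  exact div_pos (sub_pos.2 hab) hm

theorem primitive_trapezoid (m a b : ℝ) (y : I) : primitive (trapezoid m a b) y =
    (flank m a b)⁻¹ * (primitive (step a (a + flank m a b)) y -
      primitive (step (b - flank m a b) b) y) := by
  rw [trapezoid, map_smul, map_sub, ContinuousMap.smul_apply, ContinuousMap.sub_apply, smul_eq_mul]

theorem primitive_trapezoid_of_le (hm : 1 < m) (hab : a < b) {y : I} (hy : (y : ℝ) ≤ a) :
    primitive (trapezoid m a b) y = 0 := by
  have hflank := flank_pos hm hab
  have plateau := add_flank_lt_sub_flank (zero_lt_one.trans hm) hab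
  rw [primitive_trapezoid, primitive_step_of_le hy, primitive_step_of_le (by linarith), sub_zero,
    mul_zero]

theorem primitive_trapezoid_of_ge (hm : 1 < m) (ha : 0 ≤ a) (hab : a < b) {y : I} (hy : b ≤ y) :
    primitive (trapezoid m a b) y = 0 := by
  have hflank := flank_pos hm hab
  have plateau := add_flank_lt_sub_flank (zero_lt_one.trans hm) hab
  rw [primitive_trapezoid, primitive_step_of_ge ha (by linarith) (by linarith),
    primitive_step_of_ge (by linarith) (by linarith) hy, add_sub_cancel_left, sub_sub_cancel,
    sub_self, mul_zero]

theorem primitive_trapezoid_of_mem (hm : 1 < m) (ha : 0 ≤ a) (hab : a < b) {y : I}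
    (hy : (y : ℝ) ∈ centered m a b) : primitive (trapezoid m a b) y = 1 := by
  have hflank := flank_pos hm hab
  rw [centered_eq_Icc_flank (zero_lt_one.trans hm).ne'] at hy
  rw [primitive_trapezoid, primitive_step_of_ge ha (by linarith) hy.1,
    primitive_step_of_le hy.2, add_sub_cancel_left, sub_zero, inv_mul_cancel₀ hflank.ne']

theorem inner_step_step_of_le {p q r : ℝ} (hp : 0 ≤ p) (hqr : q ≤ r) (hq : q ≤ 1) (s : ℝ) :
    inner ℝ (step p q) (step r s) = 0 := by
  rw [inner_step_step hp hq]
  exact max_eq_right (sub_nonpos.2 ((min_le_left _ _).trans (hqr.trans (le_max_right _ _))))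

theorem norm_trapezoid_sq (hm : 1 < m) (ha : 0 ≤ a) (hab : a < b) (hb : b ≤ 1) :
    ‖trapezoid m a b‖ ^ 2 = 2 / flank m a b := by
  have hflank := flank_pos hm hab
  have plateau := add_flank_lt_sub_flank (zero_lt_one.trans hm) hab
  rw [trapezoid, norm_smul, mul_pow, norm_sub_sq_real, norm_step_sq ha (by linarith) (by linarith),
    norm_step_sq (by linarith) (by linarith) hb,
    inner_step_step_of_le ha plateau.le (by linarith), Real.norm_eq_abs, sq_abs]
  field_simp
  ring

theorem inner_trapezoid_eq_zero (hm : 1 < m) (ha : 0 ≤ a) (hab : a < b) {a' b' : ℝ} (hb : b ≤ a')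
    (hab' : a' < b') (hb' : b' ≤ 1) : inner ℝ (trapezoid m a b) (trapezoid m a' b') = 0 := by
  have hflank := flank_pos hm hab
  have hflank' := flank_pos hm hab'
  have plateau := add_flank_lt_sub_flank (zero_lt_one.trans hm) hab
  have plateau' := add_flank_lt_sub_flank (zero_lt_one.trans hm) hab'
  rw [trapezoid, trapezoid, real_inner_smul_left, real_inner_smul_right, inner_sub_left,
    inner_sub_right, inner_sub_right]
  repeat rw [inner_step_step_of_le (by linarith) (by linarith) (by linarith)]
  simp only [sub_self, mul_zero]

variable (ν : Measure ℝ) [IsFiniteMeasure ν]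

theorem inner_embed_trapezoid_eq_zero (hm : 1 < m) (ha : 0 ≤ a) (hab : a < b) {a' b' : ℝ}
    (hb : b ≤ a') (hab' : a' < b') :
    inner ℝ (embed ν (trapezoid m a b)) (embed ν (trapezoid m a' b')) = 0 := by
  rw [inner_embed, innerL2]
  refine integral_eq_zero_of_ae (Eventually.of_forall fun x => ?_)
  rcases le_total (x : ℝ) b with hx | hx
  · simp only [primitive_trapezoid_of_le hm hab' (hx.trans hb), mul_zero, Pi.zero_apply]
  · simp only [primitive_trapezoid_of_ge hm ha hab hx, zero_mul, Pi.zero_apply]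

theorem measureReal_centered_le (hm : 1 < m) (ha : 0 ≤ a) (hab : a < b) (hb : b ≤ 1) :
    ν.real (centered m a b) ≤ ‖embed ν (trapezoid m a b)‖ ^ 2 := by
  have hflank := flank_pos hm hab
  have measurableSet_centered : MeasurableSet (centered m a b) := measurableSet_Icc
  have centered_subset : centered m a b ⊆ Icc 0 1 := by
    rw [centered_eq_Icc_flank (zero_lt_one.trans hm).ne']
    exact Icc_subset_Icc (by linarith) (by linarith)
  calc ν.real (centered m a b) = ∫ _ in centered m a b, (1 : ℝ) ∂ν := by
        rw [setIntegral_const, smul_eq_mul, mul_one]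
    _ = ∫ y in centered m a b, (∫ t in (0 : ℝ)..y, trapezoid m a b t) ^ 2 ∂ν := by
        refine setIntegral_congr_fun measurableSet_centered fun y hy => ?_
        have primitive_eq_one := primitive_trapezoid_of_mem hm ha hab
          (y := ⟨y, centered_subset hy⟩) hy
        rw [primitive_apply] at primitive_eq_one
        simp only [primitive_eq_one, one_pow]
    _ ≤ ∫ y in Icc (0 : ℝ) 1, (∫ t in (0 : ℝ)..y, trapezoid m a b t) ^ 2 ∂ν :=
        setIntegral_mono_set (integrableOn_primitive_sq _)
          (Eventually.of_forall fun y => sq_nonneg _) centered_subset.eventuallyLE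
    _ = ‖embed ν (trapezoid m a b)‖ ^ 2 := (norm_embed_sq _).symm

theorem norm_trapezoid_sq_le {x : ℝ} (hx : 0 < x) (hm : 1 < m) (ha : 0 ≤ a) (hab : a < b)
    (hb : b ≤ 1)
    (hx' : 4 / (x * (m - 1)) ≤ ν.real (centered m a b) * volume.real (centered m a b)) :
    ‖trapezoid m a b‖ ^ 2 ≤ x * ‖embed ν (trapezoid m a b)‖ ^ 2 := by
  have m_pos : 0 < m := zero_lt_one.trans hm
  have volume_centered : volume.real (centered m a b) = (b - a) / m := by
    rw [centered_eq_Icc_flank m_pos.ne',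
      Real.volume_real_Icc_of_le (add_flank_lt_sub_flank m_pos hab).le,
      sub_flank_sub_add_flank m_pos.ne']
  have two_div_flank_le : 2 / flank m a b ≤ x * ν.real (centered m a b) := by
    rw [volume_centered, div_le_iff₀ (mul_pos hx (sub_pos.2 hm))] at hx'
    rw [div_le_iff₀ (flank_pos hm hab), flank]
    field_simp at hx' ⊢
    linarith
  rw [norm_trapezoid_sq hm ha hab hb]
  exact two_div_flank_le.trans
    (mul_le_mul_of_nonneg_left (measureReal_centered_le ν hm ha hab hb) hx.le)

end Trapezoid

/-! ### The lower bound for the counting function -/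

theorem norm_sum_smul_sq_of_pairwise_inner_eq_zero {ι E : Type*} [Fintype ι]
    [NormedAddCommGroup E] [InnerProductSpace ℝ E] {v : ι → E}
    (hv : Pairwise fun i j => inner ℝ (v i) (v j) = 0) (c : ι → ℝ) :
    ‖∑ i, c i • v i‖ ^ 2 = ∑ i, c i ^ 2 * ‖v i‖ ^ 2 := by
  classical
  have orthogonalFamily := OrthogonalFamily.of_pairwise (𝕜 := ℝ) (V := fun i => ℝ ∙ v i)
    fun i j hij => Submodule.isOrtho_span.2 (by simpa using hv hij)
  refine (orthogonalFamily.norm_sum (fun i => c i • ⟨v i, Submodule.mem_span_singleton_self _⟩)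
    Finset.univ).trans (Finset.sum_congr rfl fun i _ => ?_)
  rw [norm_smul, mul_pow, Real.norm_eq_abs, sq_abs]
  rfl

theorem norm_sq_le_of_mem_span_range {ι H K : Type*} [Finite ι] [NormedAddCommGroup H]
    [InnerProductSpace ℝ H] [NormedAddCommGroup K] [InnerProductSpace ℝ K] (b : H →L[ℝ] K) {x : ℝ}
    {u : ι → H} (hu : Pairwise fun i j => inner ℝ (u i) (u j) = 0)
    (hbu : Pairwise fun i j => inner ℝ (b (u i)) (b (u j)) = 0)
    (hle : ∀ i, ‖u i‖ ^ 2 ≤ x * ‖b (u i)‖ ^ 2) {v : H}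
    (hv : v ∈ Submodule.span ℝ (Set.range u)) : ‖v‖ ^ 2 ≤ x * ‖b v‖ ^ 2 := by
  have := Fintype.ofFinite ι
  obtain ⟨c, rfl⟩ := (Submodule.mem_span_range_iff_exists_fun ℝ).1 hv
  rw [map_sum, norm_sum_smul_sq_of_pairwise_inner_eq_zero hu]
  simp only [map_smul]
  rw [norm_sum_smul_sq_of_pairwise_inner_eq_zero hbu, Finset.mul_sum]
  refine Finset.sum_le_sum fun i _ => ?_
  rw [mul_left_comm]
  exact mul_le_mul_of_nonneg_left (hle i) (sq_nonneg _)

variable {ν : Measure ℝ} [IsFiniteMeasure ν] {x : ℝ}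

theorem card_le_eigenvalueCount {ι : Type*} [Fintype ι] {u : ι → L2I} (hx : 0 < x)
    (hu0 : ∀ i, u i ≠ 0) (hu1 : ∀ i, primitive (u i) 1 = 0)
    (hu : Pairwise fun i j => inner ℝ (u i) (u j) = 0)
    (hembed : Pairwise fun i j => inner ℝ (embed ν (u i)) (embed ν (u j)) = 0)
    (hle : ∀ i, ‖u i‖ ^ 2 ≤ x * ‖embed ν (u i)‖ ^ 2) :
    (Fintype.card ι : ℕ∞) ≤ eigenvalueCount ν x := by
  rw [← finrank_span_eq_card (linearIndependent_of_ne_zero_of_inner_eq_zero (𝕜 := ℝ) hu0 hu)]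
  have := FiniteDimensional.span_of_finite ℝ (Set.finite_range u)
  refine finrank_le_eigenvalueCount hx _ ?_ fun v hv =>
    norm_sq_le_of_mem_span_range (embed ν) hu hembed hle hv
  have span_le : Submodule.span ℝ (Set.range u) ≤
      LinearMap.ker ((ContinuousMap.evalCLM ℝ (1 : I) ∘L primitive : L2I →L[ℝ] ℝ) : L2I →ₗ[ℝ] ℝ) :=
    Submodule.span_le.2 (Set.range_subset_iff.2 hu1)
  exact fun v hv => span_le hv

theorem le_or_le_of_disjoint_Ioc {a b a' b' : ℝ} (hab : a < b) (hab' : a' < b')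
    (h : Disjoint (Ioc a b) (Ioc a' b')) : b ≤ a' ∨ b' ≤ a := by
  rw [Ioc_disjoint_Ioc, min_le_iff, le_max_iff, le_max_iff] at h
  grind

theorem reducedCount_le_eigenvalueCount {m : ℝ} (hm : 1 < m) (hx : 0 < x) :
    reducedCount ν m x ≤ eigenvalueCount ν x := by
  refine sSup_le ?_
  rintro _ ⟨P, rfl, ⟨hP, hdisj⟩, hPx⟩
  have separated (p q : P) (hpq : p ≠ q) : p.1.2 ≤ q.1.1 ∨ q.1.2 ≤ p.1.1 :=
    le_or_le_of_disjoint_Ioc (hP p p.2).2.1 (hP q q.2).2.1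
      (hdisj p.2 q.2 (Subtype.coe_ne_coe.2 hpq))
  let u : P → L2I := fun p => trapezoid m p.1.1 p.1.2
  have u_ne_zero (p : P) : u p ≠ 0 := by
    obtain ⟨ha, hab, hb, -⟩ := hP p p.2
    rw [← norm_ne_zero_iff, ← pow_ne_zero_iff two_ne_zero, norm_trapezoid_sq hm ha hab hb]
    exact (div_pos two_pos (flank_pos hm hab)).ne'
  rw [← Fintype.card_coe]
  refine card_le_eigenvalueCount hx u_ne_zero
    (fun p => primitive_trapezoid_of_ge hm (hP p p.2).1 (hP p p.2).2.1 (hP p p.2).2.2.1)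
    (fun p q hpq => ?_) (fun p q hpq => ?_) fun p => norm_trapezoid_sq_le ν hx hm (hP p p.2).1
      (hP p p.2).2.1 (hP p p.2).2.2.1 (hPx p p.2) <;>
    obtain ⟨ha, hab, hb, -⟩ := hP p p.2 <;> obtain ⟨ha', hab', hb', -⟩ := hP q q.2
  · rcases separated p q hpq with h | h
    · exact inner_trapezoid_eq_zero hm ha hab h hab' hb'
    · rw [real_inner_comm]
      exact inner_trapezoid_eq_zero hm ha' hab' h hab hb
  · rcases separated p q hpq with h | h
    · exact inner_embed_trapezoid_eq_zero ν hm ha hab h hab'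
    · rw [real_inner_comm]
      exact inner_embed_trapezoid_eq_zero ν hm ha' hab' h hab

/-! ### The chain of inequalities -/

section Chain

variable {ν : Measure ℝ} [IsFiniteMeasure ν] {m : ℝ}

theorem lowerReducedEntropy_le_lowerSpectralDim (hm : 1 < m) :
    lowerReducedEntropy ν m ≤ lowerSpectralDim ν :=
  lowerExponent_mono ((eventually_gt_atTop 0).mono fun _ => reducedCount_le_eigenvalueCount hm)

theorem upperReducedEntropy_le_upperSpectralDim (hm : 1 < m) :
    upperReducedEntropy ν m ≤ upperSpectralDim ν :=
  upperExponent_mono ((eventually_gt_atTop 0).mono fun _ => reducedCount_le_eigenvalueCount hm)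

theorem lowerSpectralDim_le_lowerEntropy : lowerSpectralDim ν ≤ lowerEntropy ν :=
  lowerExponent_mono ((eventually_gt_atTop 0).mono fun _ => eigenvalueCount_le_partitionCount)

theorem upperSpectralDim_le_upperEntropy : upperSpectralDim ν ≤ upperEntropy ν :=
  upperExponent_mono ((eventually_gt_atTop 0).mono fun _ => eigenvalueCount_le_partitionCount)

theorem lowerSpectralDim_le_upperEntropy : lowerSpectralDim ν ≤ upperEntropy ν :=
  lowerSpectralDim_le_lowerEntropy.trans (lowerExponent_le_upperExponent _)

theorem iSup_lowerReducedEntropy_le_lowerSpectralDim :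
    ⨆ (m : ℝ) (_ : 1 < m), lowerReducedEntropy ν m ≤ lowerSpectralDim ν :=
  iSup₂_le fun _ => lowerReducedEntropy_le_lowerSpectralDim

end Chain

section Carried

variable {ν : Measure ℝ}

theorem measure_Ioo_ne_zero (hν : ν (Ioo 0 1)ᶜ = 0) (hν0 : ν ≠ 0) : ν (Ioo 0 1) ≠ 0 :=
  fun h => hν0 (Measure.measure_univ_eq_zero.1
    (by rw [← measure_add_measure_compl measurableSet_Ioo, h, hν, add_zero]))

theorem measure_Ioc_ne_zero (hν : ν (Ioo 0 1)ᶜ = 0) (hν0 : ν ≠ 0) : ν (Ioc 0 1) ≠ 0 :=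
  fun h => measure_Ioo_ne_zero hν hν0 (measure_mono_null Ioo_subset_Ioc_self h)

variable [IsFiniteMeasure ν]

theorem upperEntropy_le_upperFixedPoint_of_carried (hν : ν (Ioo 0 1)ᶜ = 0) (hν0 : ν ≠ 0) :
    upperEntropy ν ≤ upperFixedPoint ν :=
  upperEntropy_le_upperFixedPoint (measure_mono_null (by simp) hν)
    (measure_mono_null (by simp) hν) (measure_Ioc_ne_zero hν hν0)

theorem upperEntropy_le_upperCoarseDim (hν : ν (Ioo 0 1)ᶜ = 0) (hν0 : ν ≠ 0) :
    upperEntropy ν ≤ upperCoarseDim ν :=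
  (upperEntropy_le_upperFixedPoint_of_carried hν hν0).trans
    (upperFixedPoint_le_upperCoarseDim (measure_Ioc_ne_zero hν hν0))

theorem upperEntropy_eq_upperReducedEntropy (hν : ν (Ioo 0 1)ᶜ = 0) (hν0 : ν ≠ 0) {m : ℝ}
    (hm : 1 < m) : upperEntropy ν = upperReducedEntropy ν m :=
  ((upperEntropy_le_upperCoarseDim hν hν0).trans
    (upperCoarseDim_le_upperReducedEntropy (measure_Ioo_ne_zero hν hν0) hm)).antisymm
    ((upperReducedEntropy_le_upperSpectralDim hm).trans upperSpectralDim_le_upperEntropy)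

theorem upperSpectralDim_eq_upperEntropy (hν : ν (Ioo 0 1)ᶜ = 0) (hν0 : ν ≠ 0) :
    upperSpectralDim ν = upperEntropy ν :=
  upperSpectralDim_le_upperEntropy.antisymm
    ((upperEntropy_eq_upperReducedEntropy hν hν0 one_lt_two).trans_le
      (upperReducedEntropy_le_upperSpectralDim one_lt_two))

theorem upperCoarseDim_le_upperEntropy (hν : ν (Ioo 0 1)ᶜ = 0) (hν0 : ν ≠ 0) :
    upperCoarseDim ν ≤ upperEntropy ν :=
  (upperCoarseDim_le_upperReducedEntropy (measure_Ioo_ne_zero hν hν0) one_lt_two).trans_eq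
    (upperEntropy_eq_upperReducedEntropy hν hν0 one_lt_two).symm

theorem upperFixedPoint_eq_upperCoarseDim (hν : ν (Ioo 0 1)ᶜ = 0) (hν0 : ν ≠ 0) :
    upperFixedPoint ν = upperCoarseDim ν :=
  (upperFixedPoint_le_upperCoarseDim (measure_Ioc_ne_zero hν hν0)).antisymm
    ((upperCoarseDim_le_upperEntropy hν hν0).trans
      (upperEntropy_le_upperFixedPoint_of_carried hν hν0))

theorem upperSpectralDim_eq_upperFixedPoint (hν : ν (Ioo 0 1)ᶜ = 0) (hν0 : ν ≠ 0) :
    upperSpectralDim ν = upperFixedPoint ν := by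
  rw [upperSpectralDim_eq_upperEntropy hν hν0, upperFixedPoint_eq_upperCoarseDim hν hν0]
  exact (upperEntropy_le_upperCoarseDim hν hν0).antisymm (upperCoarseDim_le_upperEntropy hν hν0)

theorem IsMFRegular.upperEntropy_le_lowerCoarseDim (hreg : IsMFRegular ν)
    (hν : ν (Ioo 0 1)ᶜ = 0) (hν0 : ν ≠ 0) : upperEntropy ν ≤ lowerCoarseDim ν :=
  (upperEntropy_le_upperCoarseDim hν hν0).trans_eq (Eq.symm hreg)

theorem IsMFRegular.lower_chain_eq (hreg : IsMFRegular ν) (hν : ν (Ioo 0 1)ᶜ = 0) (hν0 : ν ≠ 0)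
    {m : ℝ} (hm : 1 < m) : lowerCoarseDim ν = lowerReducedEntropy ν m ∧
      lowerReducedEntropy ν m = lowerSpectralDim ν ∧ lowerSpectralDim ν = lowerEntropy ν ∧
      lowerEntropy ν = upperEntropy ν := by
  have coarse_le := lowerCoarseDim_le_lowerReducedEntropy (measure_Ioo_ne_zero hν hν0) hm
  have reduced_le := lowerReducedEntropy_le_lowerSpectralDim (ν := ν) hm
  have spectral_le := lowerSpectralDim_le_lowerEntropy (ν := ν)
  have entropy_le : lowerEntropy ν ≤ upperEntropy ν := lowerExponent_le_upperExponent _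
  have le_coarse := hreg.upperEntropy_le_lowerCoarseDim hν hν0
  refine ⟨coarse_le.antisymm ?_, reduced_le.antisymm ?_, spectral_le.antisymm ?_,
    entropy_le.antisymm ?_⟩ <;> order

theorem IsMFRegular.isRegular (hreg : IsMFRegular ν) (hν : ν (Ioo 0 1)ᶜ = 0) (hν0 : ν ≠ 0) :
    IsRegular ν :=
  (iSup_lowerReducedEntropy_le_lowerSpectralDim.trans lowerSpectralDim_le_upperEntropy).antisymm
    ((hreg.upperEntropy_le_lowerCoarseDim hν hν0).trans
      ((lowerCoarseDim_le_lowerReducedEntropy (measure_Ioo_ne_zero hν hν0) one_lt_two).trans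
        (le_iSup₂ (f := fun (m : ℝ) (_ : 1 < m) => lowerReducedEntropy ν m) 2 one_lt_two)))

end Carried

end KreinFeller

end

open KreinFeller in
theorem theorem1p1_general (ν : Measure ℝ) [IsFiniteMeasure ν]
    (hν : ν (Ioo (0 : ℝ) 1)ᶜ = 0) (hν0 : ν ≠ 0) :
    (∀ n : ℕ, 1 ≤ n → ν.real univ < 2 ^ n → ∃! q : ℝ, lqBeta ν n q = q) ∧
    (∀ m : ℝ, 1 < m →
      lowerCoarseDim ν ≤ lowerReducedEntropy ν m ∧
      lowerReducedEntropy ν m ≤ lowerSpectralDim ν ∧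
      lowerSpectralDim ν ≤ lowerEntropy ν ∧
      lowerEntropy ν ≤ upperEntropy ν ∧
      upperEntropy ν = upperReducedEntropy ν m ∧
      upperReducedEntropy ν m = upperSpectralDim ν ∧
      upperSpectralDim ν = upperFixedPoint ν ∧
      upperFixedPoint ν = upperCoarseDim ν) ∧
    upperFixedPoint ν ≤ ((1 / 2 : ℝ) : EReal) ∧
    (lowerSpectralDim ν = upperSpectralDim ν →
      lowerEntropy ν = upperEntropy ν ∧
      upperEntropy ν = upperSpectralDim ν) ∧
    (IsRegular ν →
      lowerSpectralDim ν = upperSpectralDim ν ∧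
      upperSpectralDim ν = upperEntropy ν) ∧
    (IsMFRegular ν →
      (∀ m : ℝ, 1 < m →
        lowerCoarseDim ν = lowerReducedEntropy ν m ∧
        lowerReducedEntropy ν m = lowerSpectralDim ν ∧
        lowerSpectralDim ν = lowerEntropy ν ∧
        lowerEntropy ν = upperEntropy ν) ∧
      IsRegular ν) ∧
    (∀ m : ℝ, 1 < m → ((1 / 2 : ℝ) : EReal) ≤ lowerReducedEntropy ν m →
      lowerSpectralDim ν = ((1 / 2 : ℝ) : EReal) ∧
      upperSpectralDim ν = ((1 / 2 : ℝ) : EReal) ∧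
      upperEntropy ν = ((1 / 2 : ℝ) : EReal)) := by
  have hs := upperSpectralDim_eq_upperEntropy hν hν0
  have hhalf := upperFixedPoint_le_half (measure_Ioc_ne_zero hν hν0)
  have lower_le_upper : lowerSpectralDim ν ≤ upperSpectralDim ν := lowerExponent_le_upperExponent _
  refine ⟨fun n hn hpow => existsUnique_lqBeta_eq_self (measure_Ioc_ne_zero hν hν0)
      (Nat.one_le_iff_ne_zero.1 hn) hpow,
    fun m hm => ⟨lowerCoarseDim_le_lowerReducedEntropy (measure_Ioo_ne_zero hν hν0) hm,
      lowerReducedEntropy_le_lowerSpectralDim hm, lowerSpectralDim_le_lowerEntropy,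
      lowerExponent_le_upperExponent _, upperEntropy_eq_upperReducedEntropy hν hν0 hm,
      (upperEntropy_eq_upperReducedEntropy hν hν0 hm).symm.trans hs.symm,
      upperSpectralDim_eq_upperFixedPoint hν hν0, upperFixedPoint_eq_upperCoarseDim hν hν0⟩,
    hhalf, fun heq => ⟨(lowerExponent_le_upperExponent _).antisymm ?_, hs.symm⟩,
    fun hreg => ⟨lower_le_upper.antisymm ?_, hs⟩,
    fun hreg => ⟨fun m hm => hreg.lower_chain_eq hν hν0 hm, hreg.isRegular hν hν0⟩,
    fun m hm hle => ?_⟩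
  · exact hs.symm.trans_le (heq.symm.trans_le lowerSpectralDim_le_lowerEntropy)
  · exact hs.trans_le ((Eq.symm hreg).trans_le iSup_lowerReducedEntropy_le_lowerSpectralDim)
  · have half_le := hle.trans (lowerReducedEntropy_le_lowerSpectralDim hm)
    have upper_eq := ((upperSpectralDim_eq_upperFixedPoint hν hν0).trans_le hhalf).antisymm
      (half_le.trans lower_le_upper)
    exact ⟨(lower_le_upper.trans_eq upper_eq).antisymm half_le, upper_eq, hs.symm.trans upper_eq⟩

theorem theorem1p1 (ν : MeasureTheory.Measure ℝ) [MeasureTheory.IsFiniteMeasure ν]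
    (hν : ν (Set.Ioo (0 : ℝ) 1)ᶜ = 0) (hν0 : ν ≠ 0) :
    -- the fixed points of `βₙ` exist and are unique as soon as `2ⁿ` exceeds the total mass
    (∀ n : ℕ, 1 ≤ n → ν.real Set.univ < 2 ^ n → ∃! q : ℝ, KreinFeller.lqBeta ν n q = q) ∧
    -- the chain of inequalities
    (∀ m : ℝ, 1 < m → m ≤ 3 →
      KreinFeller.lowerCoarseDim ν ≤ KreinFeller.lowerReducedEntropy ν m ∧
      KreinFeller.lowerReducedEntropy ν m ≤ KreinFeller.lowerSpectralDim ν ∧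
      KreinFeller.lowerSpectralDim ν ≤ KreinFeller.lowerEntropy ν ∧
      KreinFeller.lowerEntropy ν ≤ KreinFeller.upperEntropy ν ∧
      KreinFeller.upperEntropy ν = KreinFeller.upperReducedEntropy ν m ∧
      KreinFeller.upperReducedEntropy ν m = KreinFeller.upperSpectralDim ν ∧
      KreinFeller.upperSpectralDim ν = KreinFeller.upperFixedPoint ν ∧
      KreinFeller.upperFixedPoint ν = KreinFeller.upperCoarseDim ν) ∧
    KreinFeller.upperFixedPoint ν ≤ ((1 / 2 : ℝ) : EReal) ∧
    -- necessary condition for the spectral dimension to exist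
    (KreinFeller.lowerSpectralDim ν = KreinFeller.upperSpectralDim ν →
      KreinFeller.lowerEntropy ν = KreinFeller.upperEntropy ν ∧
      KreinFeller.upperEntropy ν = KreinFeller.upperSpectralDim ν) ∧
    -- sufficient condition for the spectral dimension to exist
    (KreinFeller.IsRegular ν →
      KreinFeller.lowerSpectralDim ν = KreinFeller.upperSpectralDim ν ∧
      KreinFeller.upperSpectralDim ν = KreinFeller.upperEntropy ν) ∧
    -- MF-regularity forces equality everywhere in the chain, and regularity
    (KreinFeller.IsMFRegular ν →
      (∀ m : ℝ, 1 < m → m ≤ 3 →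
        KreinFeller.lowerCoarseDim ν = KreinFeller.lowerReducedEntropy ν m ∧
        KreinFeller.lowerReducedEntropy ν m = KreinFeller.lowerSpectralDim ν ∧
        KreinFeller.lowerSpectralDim ν = KreinFeller.lowerEntropy ν ∧
        KreinFeller.lowerEntropy ν = KreinFeller.upperEntropy ν) ∧
      KreinFeller.IsRegular ν) ∧
    -- the maximal case
    (∀ m : ℝ, 1 < m → ((1 / 2 : ℝ) : EReal) ≤ KreinFeller.lowerReducedEntropy ν m →
      KreinFeller.lowerSpectralDim ν = ((1 / 2 : ℝ) : EReal) ∧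
      KreinFeller.upperSpectralDim ν = ((1 / 2 : ℝ) : EReal) ∧
      KreinFeller.upperEntropy ν = ((1 / 2 : ℝ) : EReal)) := by
  obtain ⟨fixedPoint, chain, half, spectral, regular, mfRegular, maximal⟩ :=
    theorem1p1_general ν hν hν0
  exact ⟨fixedPoint, fun m hm _ => chain m hm, half, spectral, regular, fun hreg =>
    ⟨fun m hm _ => (mfRegular hreg).1 m hm, (mfRegular hreg).2⟩, maximal⟩
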